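/- Let $n\ge 1$ be odd and consider $n$ qubits numbered $1,\dots,n$, with $X_j$, $Z_j$ the Pauli matrices acting on qubit $j$. For real coefficients $\omega_A,\omega_B,\gamma_{AB},\gamma_{BA}$ let $$H_Z=\omega_A\sum_{j=1}^{(n-1)/2} Z_{2j}+\omega_B\sum_{j=0}^{(n-1)/2}Z_{2j+1}+\gamma_{AB}\sum_{j=1}^{(n-1)/2}Z_{2j}Z_{2j+1}+\gamma_{BA}\sum_{j=0}^{(n-3)/2}Z_{2j+1}Z_{2j+2},\qquad H_X=\sum_{j=1}^n X_j .$$ Assume that all four coefficients are nonzero and that $\omega_A^2\ne\omega_B^2$, $\gamma_{AB}^2\ne\gamma_{BA}^2$ and $\gamma_{AB}^2\ne 4\gamma_{BA}^2$. Let $\mathcal L$ be the smallest real Lie algebra of matrices (under the commutator) containing $iH_Z$ and $iH_X$, and let $e^{\mathcal L}=\{e^{A_1}\cdots e^{A_m}: m\in\mathbb N,\ A_j\in\mathcal L\}$. Then $e^{\mathcal L}$ is contained in the unitary group $\mathcal U(2^n)$ and is dense in it up to a phase: for every $U\in\mathcal U(2^n)$ and $\varepsilon>0$ there are $V\in e^{\mathcal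 L}$ and $\theta\in\mathbb R$ with $\|V-e^{i\theta}U\|<\varepsilon$ in operator norm. Moreover QAOA with $H_Z$ and $H_X$ is universal: for every $U\in\mathcal U(2^n)$ and $\varepsilon>0$ there are $p\ge 1$, angles $\gamma_1,\dots,\gamma_p,\beta_1,\dots,\beta_p\in[0,2\pi]$ and $\theta\in\mathbb R$ such that $V=e^{-i\beta_pH_X}e^{-i\gamma_pH_Z}\cdots e^{-i\beta_1H_X}e^{-i\gamma_1H_Z}$ satisfies $\|V-e^{i\theta}U\|<\varepsilon$. -/

import Mathlib

/-!
Qubit operators, the alternating one-dimensional chain, and the unitaries generated by it.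
-/

/-- Operators on `n` qubits: complex matrices whose rows and columns are indexed by the
computational basis, i.e. by bit strings of length `n`. -/
abbrev QubitOp (n : ℕ) : Type := Matrix (Fin n → Fin 2) (Fin n → Fin 2) ℂ

/-- The Pauli matrix `X`. -/
def pauliX : Matrix (Fin 2) (Fin 2) ℂ := !![0, 1; 1, 0]

/-- The Pauli matrix `Z`. -/
def pauliZ : Matrix (Fin 2) (Fin 2) ℂ := !![1, 0; 0, -1]

/-- The tensor (Kronecker) product of `n` one-qubit operators. -/
def tensorOp {n : ℕ} (P : Fin n → Matrix (Fin 2) (Fin 2) ℂ) : QubitOp n :=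
  Matrix.of fun s t => ∏ i, P i (s i) (t i)

/-- The one-qubit operator `A` acting on qubit `k` and as the identity on all others. Qubits are
numbered `1, …, n`, so the tensor factor `i : Fin n` is the qubit `i + 1`; only labels `k` with
`1 ≤ k ≤ n` are used below. -/
def siteOp (n : ℕ) (A : Matrix (Fin 2) (Fin 2) ℂ) (k : ℕ) : QubitOp n :=
  tensorOp fun i => if (i : ℕ) + 1 = k then A else 1

/-- The mixer Hamiltonian `∑_{j=1}^n X_j`. -/
noncomputable def mixerH (n : ℕ) : QubitOp n :=
  ∑ j ∈ Finset.Icc 1 n, siteOp n pauliX j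

/-- `∑ Z_{2j}`, over the even-numbered qubits. -/
noncomputable def chainA (n : ℕ) : QubitOp n :=
  ∑ j ∈ Finset.Icc 1 (n / 2), siteOp n pauliZ (2 * j)

/-- `∑ Z_{2j+1}`, over the odd-numbered qubits. -/
noncomputable def chainB (n : ℕ) : QubitOp n :=
  ∑ j ∈ Finset.range ((n + 1) / 2), siteOp n pauliZ (2 * j + 1)

/-- `∑ Z_{2j} Z_{2j+1}`, over the bonds `(2,3), (4,5), …` of the open chain. -/
noncomputable def chainAB (n : ℕ) : QubitOp n :=
  ∑ j ∈ Finset.Icc 1 ((n - 1) / 2), siteOp n pauliZ (2 * j) * siteOp n pauliZ (2 * j + 1)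

/-- `∑ Z_{2j+1} Z_{2j+2}`, over the bonds `(1,2), (3,4), …` of the open chain. -/
noncomputable def chainBA (n : ℕ) : QubitOp n :=
  ∑ j ∈ Finset.range (n / 2), siteOp n pauliZ (2 * j + 1) * siteOp n pauliZ (2 * j + 2)

/-- The cost Hamiltonian `ω_A H_A + ω_B H_B + γ_AB H_AB + γ_BA H_BA` of the open chain. -/
noncomputable def chainH (n : ℕ) (ωA ωB γAB γBA : ℝ) : QubitOp n :=
  ωA • chainA n + ωB • chainB n + γAB • chainAB n + γBA • chainBA n

/-- `U(H, α) = e^{-iαH}`. -/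
noncomputable def evolution {n : ℕ} (H : QubitOp n) (α : ℝ) : QubitOp n :=
  NormedSpace.exp ((-(Complex.I * (α : ℂ))) • H)

/-- The unitaries `U(H_X,β_p) U(H_Z,γ_p) ⋯ U(H_X,β_1) U(H_Z,γ_1)` realised by `p` layers of QAOA
with all angles in `[0, 2π]`. -/
def qaoaCircuits {n : ℕ} (HZ HX : QubitOp n) (p : ℕ) : Set (QubitOp n) :=
  {V | ∃ γ β : Fin p → ℝ,
    (∀ j, γ j ∈ Set.Icc 0 (2 * Real.pi)) ∧ (∀ j, β j ∈ Set.Icc 0 (2 * Real.pi)) ∧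
    V = ((List.ofFn fun j => evolution HX (β j) * evolution HZ (γ j)).reverse).prod}

/-- The unitaries realised by QAOA with any positive number of layers. -/
def qaoaUnitaries {n : ℕ} (HZ HX : QubitOp n) : Set (QubitOp n) :=
  ⋃ p ∈ Set.Ici 1, qaoaCircuits HZ HX p

-- The commutator bracket `⁅A, B⁆ = A * B - B * A` on matrices.
attribute [local instance 100] LieRing.ofAssociativeRing

/-- The smallest real Lie algebra (under the commutator) that contains `iH_Z` and `iH_X`. -/
noncomputable def generatedLie {n : ℕ} (HZ HX : QubitOp n) : LieSubalgebra ℝ (QubitOp n) :=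
  LieSubalgebra.lieSpan ℝ (QubitOp n) {Complex.I • HZ, Complex.I • HX}

/-- `e^𝓛`: the finite products `e^{A_1} ⋯ e^{A_m}` with all `A_j` in `𝓛`. -/
def expLie {n : ℕ} (𝓛 : LieSubalgebra ℝ (QubitOp n)) : Set (QubitOp n) :=
  {V | ∃ l : List (QubitOp n), (∀ A ∈ l, A ∈ 𝓛) ∧ V = (l.map NormedSpace.exp).prod}

/-- Every element of the full unitary group `U(2^n)` is approximated, up to a global phase and to
arbitrary precision in operator norm, by an element of `S`. -/
def ApproximatesUpToPhase {n : ℕ} (S : Set (QubitOp n)) : Prop :=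
  ∀ U ∈ Matrix.unitaryGroup (Fin n → Fin 2) ℂ, ∀ ε : ℝ, 0 < ε →
    ∃ V ∈ S, ∃ θ : ℝ,
      ‖Matrix.toEuclideanCLM (n := Fin n → Fin 2) (𝕜 := ℂ)
        (V - Complex.exp (Complex.I * (θ : ℂ)) • U)‖ < ε

/-- QAOA with cost Hamiltonian `H_Z` and mixer `H_X` is universal. -/
def QAOAUniversal {n : ℕ} (HZ HX : QubitOp n) : Prop :=
  ApproximatesUpToPhase (qaoaUnitaries HZ HX)

/-! ### Tensor products: one-site operators and neighbouring couplings generate everything. -/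

section Tensor

variable {n : ℕ}

/-! Let `𝓛` be the generated real Lie algebra and `M = 𝓛 + i𝓛 + ℂ1` (`complexSpanWithOne`), a
complex Lie algebra containing both Hamiltonians. The core is algebraic: `M` is the full matrix
algebra (`lieSubalgebra_eq_top_of_chainH_mem`).

Write `x_k, z_k` for the Pauli operators with sites counted from 0. Bracketing with the mixer
separates the field part of the cost Hamiltonian from its coupling part, since the mixer's adjoint
action has different eigenvalues on the two; brackets of fields give `∑ w_k^3 z_k` from `∑ w_k z_k`,
and as only two field strengths occur, a combination is the uniform field `∑ z_k`
(`sum_z_mem_and_ising_mem`). The uniform field rotates the ZZ-coupling into an XX-coupling. A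
quarter of the squared bracket with the XX-coupling multiplies `z_l` by the square of its local
field. That square is `γBA^2` at the first site, `γAB^2` at the last, and has eigenvalues `(γAB ±
γBA)^2` in between. A cubic polynomial therefore kills every site but the first, and the assumptions
on the couplings say exactly that it does not kill the first (`z_zero_mem`). From `z_0` the chain is
unravelled bond by bond (`z_mem_and_bond_mem`), and one-site operators with nearest-neighbour
couplings span everything under brackets (`lieSubalgebra_eq_top_of_couplings`).

The rest is Lie theory. As `𝓛` is skew-adjoint, `M = ⊤` means that every skew-adjoint matrix is an
element of `𝓛` plus an imaginary scalar; up to phase, every unitary has a skew-adjoint logarithm, so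
it lies in `e^𝓛` exactly (`exists_mem_expLie_eq_phase`). For QAOA, the closure of the circuits is a
closed monoid, and the generators of one-parameter groups inside it form a real Lie algebra
(`oneParameterLie`). It contains `iH_Z` and `iH_X`, because compactness supplies the missing
negative times, hence contains `𝓛`; so `e^𝓛` lies in the closure. -/

theorem tensorOp_mul (P Q : Fin n → Matrix (Fin 2) (Fin 2) ℂ) :
    tensorOp P * tensorOp Q = tensorOp fun i => P i * Q i := by
  ext s t
  simp only [tensorOp, Matrix.mul_apply, Matrix.of_apply, ← Finset.prod_mul_distrib]
  rw [Finset.prod_univ_sum, Fintype.piFinset_univ]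

theorem tensorOp_one : tensorOp (fun _ : Fin n => 1) = 1 := by
  ext s t
  simp only [tensorOp, Matrix.of_apply, Matrix.one_apply, Finset.prod_ite_zero, funext_iff]
  simp

theorem tensorOp_update_apply (P : Fin n → Matrix (Fin 2) (Fin 2) ℂ) (i : Fin n)
    (A : Matrix (Fin 2) (Fin 2) ℂ) (s t : Fin n → Fin 2) :
    tensorOp (Function.update P i A) s t =
      A (s i) (t i) * ∏ k ∈ Finset.univ.erase i, P k (s k) (t k) := by
  simp only [tensorOp, Matrix.of_apply]
  rw [← Finset.mul_prod_erase _ _ (Finset.mem_univ i), Function.update_self]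
  congr 1
  refine Finset.prod_congr rfl fun k hk => ?_
  rw [Function.update_of_ne (Finset.ne_of_mem_erase hk)]

/-- The embedding of one-qubit operators at the tensor factor `i`. -/
def siteHom (i : Fin n) : Matrix (Fin 2) (Fin 2) ℂ →ₐ[ℂ] QubitOp n :=
  AlgHom.ofLinearMap
    { toFun := fun A => tensorOp (Function.update (fun _ => 1) i A)
      map_add' := fun A B => by
        ext s t
        simp only [tensorOp_update_apply, Matrix.add_apply, add_mul]
      map_smul' := fun c A => by
        ext s t
        simp only [tensorOp_update_apply, Matrix.smul_apply, smul_eq_mul, mul_assoc,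
          RingHom.id_apply] }
    (by
      change tensorOp _ = 1
      rw [Function.update_eq_self_iff.2 rfl, tensorOp_one])
    (fun A B => by
      change tensorOp _ = tensorOp _ * tensorOp _
      rw [tensorOp_mul]
      congr 1
      funext k
      rcases eq_or_ne k i with rfl | h
      · simp
      · simp [h])

theorem siteHom_apply (i : Fin n) (A : Matrix (Fin 2) (Fin 2) ℂ) :
    siteHom i A = tensorOp (Function.update (fun _ => 1) i A) := rfl

theorem siteOp_succ (i : Fin n) (A : Matrix (Fin 2) (Fin 2) ℂ) :
    siteOp n A ((i : ℕ) + 1) = siteHom i A := by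
  rw [siteOp, siteHom_apply]
  congr 1
  funext k
  rcases eq_or_ne k i with rfl | h
  · simp
  · simp [h, Fin.val_eq_val]

theorem tensorOp_update_mul (P : Fin n → Matrix (Fin 2) (Fin 2) ℂ) (i : Fin n)
    (A : Matrix (Fin 2) (Fin 2) ℂ) :
    tensorOp (Function.update P i 1) * siteHom i A = tensorOp (Function.update P i A) := by
  rw [siteHom_apply, tensorOp_mul]
  congr 1
  funext k
  rcases eq_or_ne k i with rfl | h
  · simp
  · simp [h]

theorem commute_tensorOp_siteHom {P : Fin n → Matrix (Fin 2) (Fin 2) ℂ} {i : Fin n}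
    (h : P i = 1) (A : Matrix (Fin 2) (Fin 2) ℂ) : Commute (tensorOp P) (siteHom i A) := by
  rw [Commute, SemiconjBy, siteHom_apply, tensorOp_mul, tensorOp_mul]
  congr 1
  funext k
  rcases eq_or_ne k i with rfl | hk
  · simp [h]
  · simp [hk]

theorem commute_siteHom {i k : Fin n} (h : i ≠ k) (A B : Matrix (Fin 2) (Fin 2) ℂ) :
    Commute (siteHom i A) (siteHom k B) :=
  commute_tensorOp_siteHom (by simp [h.symm]) B

/-- A matrix unit is the tensor product of one-qubit matrix units. -/
theorem single_eq_tensorOp (s t : Fin n → Fin 2) :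
    Matrix.single s t (1 : ℂ) = tensorOp fun i => Matrix.single (s i) (t i) 1 := by
  ext a b
  simp only [tensorOp, Matrix.of_apply, Matrix.single_apply, Finset.prod_ite_zero]
  simp [funext_iff, forall_and]

theorem submodule_eq_top_of_tensorOp_mem (M : Submodule ℂ (QubitOp n))
    (h : ∀ P, tensorOp P ∈ M) : M = ⊤ := by
  refine eq_top_iff.2 fun A _ => ?_
  rw [Matrix.matrix_eq_sum_single A]
  refine sum_mem fun s _ => sum_mem fun t _ => ?_
  have : Matrix.single s t (A s t) = A s t • Matrix.single s t (1 : ℂ) := by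
    rw [Matrix.smul_single, smul_eq_mul, mul_one]
  rw [this, single_eq_tensorOp]
  exact M.smul_mem _ (h _)

/-- `2 × 2` matrices are spanned by the identity and the commutators. -/
theorem submodule_eq_top_of_one_of_lie (p : Submodule ℂ (Matrix (Fin 2) (Fin 2) ℂ))
    (h1 : 1 ∈ p) (h2 : ∀ A B : Matrix (Fin 2) (Fin 2) ℂ, ⁅A, B⁆ ∈ p) : p = ⊤ := by
  refine eq_top_iff.2 fun A _ => ?_
  have : A = ((A 0 0 + A 1 1) / 2) • (1 : Matrix (Fin 2) (Fin 2) ℂ)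
      + ((A 0 0 - A 1 1) / 2) • ⁅(!![0, 1; 0, 0] : Matrix (Fin 2) (Fin 2) ℂ), (!![0, 0; 1, 0] : Matrix (Fin 2) (Fin 2) ℂ)⁆
      + A 0 1 • ⁅(!![1, 0; 0, 0] : Matrix (Fin 2) (Fin 2) ℂ), (!![0, 1; 0, 0] : Matrix (Fin 2) (Fin 2) ℂ)⁆
      + A 1 0 • ⁅(!![0, 0; 0, 1] : Matrix (Fin 2) (Fin 2) ℂ), (!![0, 0; 1, 0] : Matrix (Fin 2) (Fin 2) ℂ)⁆ := by
    ext i j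
    fin_cases i <;> fin_cases j <;> simp [Ring.lie_def] <;> ring
  rw [this]
  exact add_mem (add_mem (add_mem (p.smul_mem _ h1) (p.smul_mem _ (h2 _ _)))
    (p.smul_mem _ (h2 _ _))) (p.smul_mem _ (h2 _ _))

/-- If a Lie algebra contains `W a(A)` and the couplings `a(A) b(B)` of two commuting `2 × 2` matrix
algebras that commute with `W`, then it contains `W a(A) b(B)`. -/
theorem mul_mul_mem_of_couplings {R : Type*} [Ring R] [Algebra ℂ R] (M : LieSubalgebra ℂ R)
    (a b : Matrix (Fin 2) (Fin 2) ℂ →ₐ[ℂ] R) (W : R)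
    (hab : ∀ A B, Commute (a A) (b B)) (hWa : ∀ A, Commute W (a A)) (hWb : ∀ B, Commute W (b B))
    (hW : ∀ A, W * a A ∈ M) (hM : ∀ A B, a A * b B ∈ M) (A B : Matrix (Fin 2) (Fin 2) ℂ) :
    W * a A * b B ∈ M := by
  have hlie : ∀ A₁ A₂ B, W * a ⁅A₁, A₂⁆ * b B ∈ M := fun A₁ A₂ B => by
    have : W * a ⁅A₁, A₂⁆ * b B = ⁅W * a A₁, a A₂ * b B⁆ := by
      simp only [Ring.lie_def, map_sub, map_mul]
      have e : a A₂ * b B * (W * a A₁) = W * (a A₂ * a A₁) * b B := by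
        rw [mul_assoc, ← mul_assoc (b B), ← (hWb B).eq, mul_assoc W, ← (hab A₁ B).eq,
          ← mul_assoc, ← (hWa A₂).eq]
        simp only [mul_assoc]
      rw [e]
      simp only [mul_sub, sub_mul, mul_assoc]
    rw [this]
    exact M.lie_mem (hW _) (hM _ _)
  -- The identity is not a commutator, so `hlie` misses it as first factor. It is recovered as the
  -- square of the Pauli matrix `X`, which is a commutator: bracketing `W a(X) b(B₁)` with `a(X)
  -- b(B₂)` leaves `W b([B₁, B₂])`.
  have hone : ∀ B, W * a 1 * b B ∈ M := fun B => by
    let p : Submodule ℂ (Matrix (Fin 2) (Fin 2) ℂ) :=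
      M.toSubmodule.comap ((LinearMap.mulLeft ℂ (W * a 1)).comp b.toLinearMap)
    have hp : p = ⊤ := by
      refine submodule_eq_top_of_one_of_lie p ?_ fun B₁ B₂ => ?_
      · change W * a 1 * b 1 ∈ M
        rw [map_one b, mul_one]
        exact hW 1
      · change W * a 1 * b ⁅B₁, B₂⁆ ∈ M
        let X : Matrix (Fin 2) (Fin 2) ℂ := !![0, 1; 1, 0]
        have hX : X =
            ⁅(!![1 / 2, 0; 0, -(1 / 2)] : Matrix (Fin 2) (Fin 2) ℂ), (!![0, 1; -1, 0] : Matrix (Fin 2) (Fin 2) ℂ)⁆ := by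
          ext i j
          fin_cases i <;> fin_cases j <;> simp [Ring.lie_def, X] <;> norm_num
        have hXX : a X * a X = 1 := by
          rw [← map_mul, ← map_one a]
          congr 1
          ext i j
          fin_cases i <;> fin_cases j <;> simp [X]
        have e : W * a 1 * b ⁅B₁, B₂⁆ = ⁅W * a X * b B₁, a X * b B₂⁆ := by
          have e1 : W * a X * b B₁ * (a X * b B₂) = W * (a X * a X) * (b B₁ * b B₂) := by
            rw [mul_assoc (W * a X), ← mul_assoc (b B₁), ← (hab X B₁).eq]
            simp only [mul_assoc]
          have e2 : a X * b B₂ * (W * a X * b B₁) = W * (a X * a X) * (b B₂ * b B₁) := by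
            rw [mul_assoc (a X), ← mul_assoc (b B₂), ← mul_assoc (b B₂), ← (hWb B₂).eq,
              mul_assoc W, ← (hab X B₂).eq, ← mul_assoc, ← mul_assoc, ← (hWa X).eq]
            simp only [mul_assoc]
          rw [Ring.lie_def (W * a X * b B₁), e1, e2, hXX, Ring.lie_def, map_sub, map_mul, map_mul, mul_sub, map_one]
        rw [e]
        refine M.lie_mem ?_ (hM _ _)
        rw [hX]
        exact hlie _ _ _
    have : B ∈ p := hp ▸ Submodule.mem_top
    exact this
  let p : Submodule ℂ (Matrix (Fin 2) (Fin 2) ℂ) :=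
    M.toSubmodule.comap
      (((LinearMap.mulRight ℂ (b B)).comp (LinearMap.mulLeft ℂ W)).comp a.toLinearMap)
  have hp : p = ⊤ := submodule_eq_top_of_one_of_lie p (hone B) fun A₁ A₂ => hlie A₁ A₂ B
  have : A ∈ p := hp ▸ Submodule.mem_top
  exact this

/-- On a chain, one-site operators and nearest-neighbour couplings generate all operators. -/
theorem lieSubalgebra_eq_top_of_couplings (M : LieSubalgebra ℂ (QubitOp n)) (h1 : 1 ∈ M)
    (hs : ∀ i A, siteHom (n := n) i A ∈ M)
    (hb : ∀ i k : Fin n, (k : ℕ) = i + 1 → ∀ A B, siteHom i A * siteHom k B ∈ M) :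
    M = ⊤ := by
  have key : ∀ m ≤ n, ∀ P : Fin n → Matrix (Fin 2) (Fin 2) ℂ,
      (∀ i : Fin n, m ≤ (i : ℕ) → P i = 1) → tensorOp P ∈ M := by
    intro m
    induction m with
    | zero =>
      intro _ P hP
      have : P = fun _ => 1 := funext fun i => hP i (Nat.zero_le _)
      rw [this, tensorOp_one]
      exact h1
    | succ m ih =>
      intro hm P hP
      let k : Fin n := ⟨m, hm⟩
      rcases Nat.eq_zero_or_pos m with h0 | h0
      · have : P = Function.update (fun _ => 1) k (P k) := by
          funext i
          rcases eq_or_ne i k with rfl | h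
          · simp
          · rw [Function.update_of_ne h]
            refine hP i ?_
            have : (i : ℕ) ≠ m := fun e => h (Fin.ext e)
            omega
        rw [this, ← siteHom_apply]
        exact hs _ _
      · let i : Fin n := ⟨m - 1, by omega⟩
        have hik : i ≠ k := fun e => by
          have : m - 1 = m := congrArg Fin.val e
          omega
        -- The last two occupied sites are split off. Each `W a(A)` is then trivial from site `m`
        -- on, so the induction hypothesis covers it, and the coupling of `i` and `k` adds the last
        -- factor.
        let W := Function.update (Function.update P i 1) k 1
        have hWi : W i = 1 := by simp [W, hik]
        have hWk : W k = 1 := by simp [W]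
        have e : tensorOp P = tensorOp W * siteHom i (P i) * siteHom k (P k) := by
          have e1 : Function.update W i 1 = W := Function.update_eq_self_iff.2 hWi.symm
          have e2 : tensorOp W * siteHom i (P i) = tensorOp (Function.update W i (P i)) := by
            rw [← tensorOp_update_mul W, e1]
          have e3 : Function.update W i (P i) = Function.update P k 1 := by
            funext l
            rcases eq_or_ne l i with rfl | h
            · simp [hik]
            · rcases eq_or_ne l k with rfl | h'
              · simp [h, W]
              · simp [h, h', W]
          rw [e2, e3, tensorOp_update_mul, Function.update_eq_self]
        rw [e]
        refine mul_mul_mem_of_couplings M (siteHom i) (siteHom k) (tensorOp W)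
          (commute_siteHom hik) (commute_tensorOp_siteHom hWi) (commute_tensorOp_siteHom hWk)
          (fun A => ?_) (hb i k (by simp only [i, k]; omega)) _ _
        have e1 : Function.update W i 1 = W := Function.update_eq_self_iff.2 hWi.symm
        rw [← e1, tensorOp_update_mul]
        refine ih (by omega) _ fun l hl => ?_
        have hli : l ≠ i := fun e => by
          have : (l : ℕ) = m - 1 := congrArg Fin.val e
          omega
        rw [Function.update_of_ne hli]
        rcases eq_or_ne l k with rfl | h'
        · exact hWk
        · have : (l : ℕ) ≠ m := fun e => h' (Fin.ext e)
          simp only [W, Function.update_of_ne h', Function.update_of_ne hli]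
          exact hP l (by omega)
  have : M.toSubmodule = ⊤ := submodule_eq_top_of_tensorOp_mem _ fun P =>
    key n le_rfl P fun i hi => absurd i.2 (by omega)
  exact LieSubalgebra.toSubmodule_injective (by simpa using this)

end Tensor

/-! ### Pauli relations on a chain: uniform fields and the rotated coupling. -/

section Chain

variable {R : Type*} [Ring R]

theorem lie_mul_eq_add (a b c : R) : ⁅a, b * c⁆ = ⁅a, b⁆ * c + b * ⁅a, c⁆ := by
  simp only [Ring.lie_def]
  noncomm_ring

theorem Commute.lie_eq_zero {a b : R} (h : Commute a b) : ⁅a, b⁆ = 0 := by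
  rw [Ring.lie_def, h.eq, sub_self]

theorem lie_sum_sum_of_commute {s : Finset ℕ} {a b : ℕ → R}
    (h : ∀ k ∈ s, ∀ l ∈ s, k ≠ l → Commute (a k) (b l)) :
    ⁅∑ k ∈ s, a k, ∑ k ∈ s, b k⁆ = ∑ k ∈ s, ⁅a k, b k⁆ := by
  rw [sum_lie]
  refine Finset.sum_congr rfl fun k hk => ?_
  rw [lie_sum]
  exact Finset.sum_eq_single_of_mem k hk fun l hl hlk => (h k hk l hl hlk.symm).lie_eq_zero

theorem sum_lie_of_commute {s : Finset ℕ} {a : ℕ → R} {y : R} {l : ℕ} (hl : l ∈ s)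
    (h : ∀ k ∈ s, k ≠ l → Commute (a k) y) : ⁅∑ k ∈ s, a k, y⁆ = ⁅a l, y⁆ := by
  rw [sum_lie]
  exact Finset.sum_eq_single_of_mem l hl fun k hk hkl => (h k hk hkl).lie_eq_zero

/-- The relations of the Pauli operators `x k`, `z k` at the sites `0, …, N`. -/
structure IsPauliFamily (N : ℕ) (x z : ℕ → R) : Prop where
  xx : ∀ k ≤ N, x k * x k = 1
  zz : ∀ k ≤ N, z k * z k = 1
  zx : ∀ k ≤ N, z k * x k = -(x k * z k)
  comm_xx : ∀ k ≤ N, ∀ l ≤ N, k ≠ l → Commute (x k) (x l)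
  comm_xz : ∀ k ≤ N, ∀ l ≤ N, k ≠ l → Commute (x k) (z l)
  comm_zz : ∀ k ≤ N, ∀ l ≤ N, k ≠ l → Commute (z k) (z l)

namespace IsPauliFamily

variable {N : ℕ} {x z : ℕ → R}

theorem comm_x_xz (h : IsPauliFamily N x z) : ∀ k ≤ N, ∀ l ≤ N, k ≠ l → Commute (x k) (x l * z l) :=
  fun k hk l hl hkl => (h.comm_xx k hk l hl hkl).mul_right (h.comm_xz k hk l hl hkl)

theorem comm_z_xz (h : IsPauliFamily N x z) : ∀ k ≤ N, ∀ l ≤ N, k ≠ l → Commute (z k) (x l * z l) :=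
  fun k hk l hl hkl => (h.comm_xz l hl k hk hkl.symm).symm.mul_right (h.comm_zz k hk l hl hkl)

end IsPauliFamily

variable [Algebra ℂ R]

section Pair

variable {x z : R}

theorem pauli_lie_x_z (hzx : z * x = -(x * z)) : ⁅x, z⁆ = (2 : ℂ) • (x * z) := by
  rw [Ring.lie_def, hzx, two_smul, sub_neg_eq_add]

theorem pauli_lie_x_xz (hx : x * x = 1) (hzx : z * x = -(x * z)) :
    ⁅x, x * z⁆ = (2 : ℂ) • z := by
  rw [lie_mul_eq_add, lie_self, zero_mul, zero_add, pauli_lie_x_z hzx, mul_smul_comm, ← mul_assoc,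
    hx, one_mul]

theorem pauli_lie_xz_z (hz : z * z = 1) (hzx : z * x = -(x * z)) :
    ⁅x * z, z⁆ = (2 : ℂ) • x := by
  rw [Ring.lie_def, ← mul_assoc z, hzx, mul_assoc, neg_mul, mul_assoc, hz, two_smul]
  simp

theorem pauli_lie_xz_x (hx : x * x = 1) (hzx : z * x = -(x * z)) :
    ⁅x * z, x⁆ = (-2 : ℂ) • z := by
  rw [← lie_skew, pauli_lie_x_xz hx hzx, neg_smul]

/-- Two applications of the bracket with an Ising Hamiltonian `r + x m` multiply `z` by the square
of its local field `m`. -/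
theorem ising_lie_lie {r m Y : R} (hx : x * x = 1) (hzx : z * x = -(x * z))
    (hrx : Commute r x) (hrz : Commute r z) (hrm : Commute r m) (hmx : Commute m x)
    (hmz : Commute m z) (hrY : Commute r Y) (hxY : Commute x Y) (hmY : Commute m Y) :
    ⁅r + x * m, ⁅r + x * m, z * Y⁆⁆ = (4 : ℂ) • (z * (m * m * Y)) := by
  have hq : ∀ y, Commute r y → Commute m y → ⁅r + x * m, y⁆ = ⁅x, y⁆ * m := fun y hr hm => by
    rw [add_lie, hr.lie_eq_zero, zero_add, Ring.lie_def, Ring.lie_def, mul_assoc, hm.eq, sub_mul,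
      mul_assoc, mul_assoc]
  have hY : ∀ W, Commute r W → Commute x W → Commute m W → ⁅r + x * m, W⁆ = 0 := fun W hr hx hm => by
    rw [hq _ hr hm, hx.lie_eq_zero, zero_mul]
  rw [lie_mul_eq_add, hY Y hrY hxY hmY, mul_zero, add_zero, hq z hrz hmz, pauli_lie_x_z hzx,
    smul_mul_assoc, smul_mul_assoc, lie_smul, mul_assoc, lie_mul_eq_add,
    hY (m * Y) (hrm.mul_right hrY) (hmx.symm.mul_right hxY) ((Commute.refl m).mul_right hmY),
    mul_zero, add_zero, hq _ (hrx.mul_right hrz) (hmx.mul_right hmz), pauli_lie_x_xz hx hzx,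
    smul_mul_assoc, smul_mul_assoc, smul_smul, mul_assoc z, mul_assoc m]
  norm_num

/-- The bracket with a field cubes to a multiple of itself on a two-site coupling. -/
theorem lie_lie_lie_mul {D z j z' j' : R} (hz : ⁅D, z⁆ = (2 : ℂ) • j) (hj : ⁅D, j⁆ = (2 : ℂ) • z)
    (hz' : ⁅D, z'⁆ = (2 : ℂ) • j') (hj' : ⁅D, j'⁆ = (2 : ℂ) • z') :
    ⁅D, ⁅D, ⁅D, z * z'⁆⁆⁆ = (16 : ℂ) • ⁅D, z * z'⁆ := by
  simp only [lie_mul_eq_add, hz, hz', hj, hj', lie_add, lie_smul, smul_mul_assoc, mul_smul_comm,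
    smul_add]
  module

/-- `E` acts as an infinitesimal rotation of the `z`-`x` plane at both sites, and its second bracket
with `z z'` is `8 (x x' - z z')`. This turns a ZZ-coupling into an XX-coupling. -/
theorem lie_lie_mul {E x z x' z' : R} (hz : ⁅E, z⁆ = (2 : ℂ) • x) (hx : ⁅E, x⁆ = (-2 : ℂ) • z)
    (hz' : ⁅E, z'⁆ = (2 : ℂ) • x') (hx' : ⁅E, x'⁆ = (-2 : ℂ) • z') :
    x * x' = z * z' + (1 / 8 : ℂ) • ⁅E, ⁅E, z * z'⁆⁆ := by
  simp only [lie_mul_eq_add, hz, hz', hx, hx', lie_add, lie_smul, smul_mul_assoc, mul_smul_comm,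
    smul_add]
  module

end Pair

namespace IsPauliFamily

variable {N : ℕ} {x z : ℕ → R}

theorem sum_x_lie_z (h : IsPauliFamily N x z) {l : ℕ} (hl : l ≤ N) :
    ⁅∑ k ∈ Finset.range (N + 1), x k, z l⁆ = (2 : ℂ) • (x l * z l) := by
  rw [sum_lie_of_commute (l := l) (Finset.mem_range.2 (by omega)), pauli_lie_x_z (h.zx l hl)]
  exact fun k hk hkl => h.comm_xz k (by simpa [Nat.lt_succ_iff] using hk) l hl hkl

theorem sum_x_lie_xz (h : IsPauliFamily N x z) {l : ℕ} (hl : l ≤ N) :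
    ⁅∑ k ∈ Finset.range (N + 1), x k, x l * z l⁆ = (2 : ℂ) • z l := by
  rw [sum_lie_of_commute (l := l) (Finset.mem_range.2 (by omega)),
    pauli_lie_x_xz (h.xx l hl) (h.zx l hl)]
  exact fun k hk hkl => h.comm_x_xz k (by simpa [Nat.lt_succ_iff] using hk) l hl hkl

theorem sum_xz_lie_z (h : IsPauliFamily N x z) {l : ℕ} (hl : l ≤ N) :
    ⁅∑ k ∈ Finset.range (N + 1), x k * z k, z l⁆ = (2 : ℂ) • x l := by
  rw [sum_lie_of_commute (l := l) (Finset.mem_range.2 (by omega)),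
    pauli_lie_xz_z (h.zz l hl) (h.zx l hl)]
  exact fun k hk hkl => (h.comm_z_xz l hl k (by simpa [Nat.lt_succ_iff] using hk) hkl.symm).symm

theorem sum_xz_lie_x (h : IsPauliFamily N x z) {l : ℕ} (hl : l ≤ N) :
    ⁅∑ k ∈ Finset.range (N + 1), x k * z k, x l⁆ = (-2 : ℂ) • z l := by
  rw [sum_lie_of_commute (l := l) (Finset.mem_range.2 (by omega)),
    pauli_lie_xz_x (h.xx l hl) (h.zx l hl)]
  exact fun k hk hkl => (h.comm_x_xz l hl k (by simpa [Nat.lt_succ_iff] using hk) hkl.symm).symm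

/-- The uniform fields and the Ising coupling belong to the Lie algebra generated by the mixer and
the cost Hamiltonian, if the local fields satisfy a common relation `α w + β w ^ 3 = 1`. -/
theorem sum_z_mem_and_ising_mem (h : IsPauliFamily N x z) (M : LieSubalgebra ℂ R) (w g : ℕ → ℂ)
    (α β : ℂ) (hw : ∀ k ≤ N, α * w k + β * w k ^ 3 = 1)
    (hX : ∑ k ∈ Finset.range (N + 1), x k ∈ M)
    (hH : ∑ k ∈ Finset.range (N + 1), w k • z k
      + ∑ k ∈ Finset.range N, g k • (z k * z (k + 1)) ∈ M) :
    ∑ k ∈ Finset.range (N + 1), z k ∈ M ∧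
      ∑ k ∈ Finset.range N, g k • (z k * z (k + 1)) ∈ M := by
  have hle : ∀ {k}, k ∈ Finset.range (N + 1) → k ≤ N := fun hk => by
    simpa [Nat.lt_succ_iff] using hk
  set X := ∑ k ∈ Finset.range (N + 1), x k with hXdef
  set L := ∑ k ∈ Finset.range (N + 1), w k • z k with hL
  set J := ∑ k ∈ Finset.range (N + 1), w k • (x k * z k) with hJ
  set Q := ∑ k ∈ Finset.range N, g k • (z k * z (k + 1)) with hQ
  have hXL : ⁅X, L⁆ = (2 : ℂ) • J := by
    rw [hL, hJ, lie_sum, Finset.smul_sum]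
    refine Finset.sum_congr rfl fun k hk => ?_
    rw [lie_smul, h.sum_x_lie_z (hle hk), smul_comm]
  have hXJ : ⁅X, J⁆ = (2 : ℂ) • L := by
    rw [hL, hJ, lie_sum, Finset.smul_sum]
    refine Finset.sum_congr rfl fun k hk => ?_
    rw [lie_smul, h.sum_x_lie_xz (hle hk), smul_comm]
  have hXQ : ⁅X, ⁅X, ⁅X, Q⁆⁆⁆ = (16 : ℂ) • ⁅X, Q⁆ := by
    rw [hQ, lie_sum, lie_sum, lie_sum, Finset.smul_sum]
    refine Finset.sum_congr rfl fun k hk => ?_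
    have hk' := Finset.mem_range.1 hk
    rw [lie_smul, lie_smul, lie_smul, smul_comm (16 : ℂ),
      lie_lie_lie_mul (h.sum_x_lie_z hk'.le) (h.sum_x_lie_xz hk'.le) (h.sum_x_lie_z hk')
        (h.sum_x_lie_xz hk')]
  have hJM : J ∈ M := by
    -- The operator `ad X ^ 3 - 16 ad X` annihilates the couplings `Q` and sends the fields `L` to
    -- `(8 - 32) J`.
    have e : J = (-1 / 24 : ℂ) • (⁅X, ⁅X, ⁅X, L + Q⁆⁆⁆ - (16 : ℂ) • ⁅X, L + Q⁆) := by
      simp only [lie_add, hXQ, hXL, lie_smul, hXJ]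
      module
    rw [e]
    exact M.smul_mem _ (sub_mem (M.lie_mem hX (M.lie_mem hX (M.lie_mem hX hH)))
      (M.smul_mem _ (M.lie_mem hX hH)))
  have hLM : L ∈ M := by
    have e : L = (1 / 2 : ℂ) • ⁅X, J⁆ := by
      rw [hXJ]
      module
    rw [e]
    exact M.smul_mem _ (M.lie_mem hX hJM)
  refine ⟨?_, by simpa using sub_mem hH hLM⟩
  set X2 := ∑ k ∈ Finset.range (N + 1), w k ^ 2 • x k with hX2
  have hJL : ⁅J, L⁆ = (2 : ℂ) • X2 := by
    rw [hL, hJ, lie_sum_sum_of_commute, hX2, Finset.smul_sum]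
    · refine Finset.sum_congr rfl fun k hk => ?_
      rw [lie_smul, smul_lie, pauli_lie_xz_z (h.zz k (hle hk)) (h.zx k (hle hk))]
      module
    · exact fun k hk l hl hkl => (((h.comm_z_xz l (hle hl) k (hle hk) hkl.symm).symm.smul_left
        _).smul_right _)
  have hX2J : ⁅X2, J⁆ = (2 : ℂ) • ∑ k ∈ Finset.range (N + 1), w k ^ 3 • z k := by
    rw [hX2, hJ, lie_sum_sum_of_commute, Finset.smul_sum]
    · refine Finset.sum_congr rfl fun k hk => ?_
      rw [lie_smul, smul_lie, pauli_lie_x_xz (h.xx k (hle hk)) (h.zx k (hle hk))]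
      module
    · exact fun k hk l hl hkl => ((h.comm_x_xz k (hle hk) l (hle hl) hkl).smul_left _).smul_right _
  -- The double bracket equals `4 ∑ w_k^3 z_k`, so the relation `hw` makes every field strength
  -- equal to 1.
  have e : ∑ k ∈ Finset.range (N + 1), z k = α • L + (β / 4) • ⁅⁅J, L⁆, J⁆ := by
    rw [hJL, smul_lie, hX2J, hL]
    simp only [Finset.smul_sum, ← Finset.sum_add_distrib]
    refine Finset.sum_congr rfl fun k hk => ?_
    have : z k = (α * w k + β * w k ^ 3) • z k := by rw [hw k (hle hk), one_smul]
    conv_lhs => rw [this]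
    module
  rw [e]
  exact add_mem (M.smul_mem _ hLM) (M.smul_mem _ (M.lie_mem (M.lie_mem hJM hLM) hJM))

theorem sum_xz_mem (h : IsPauliFamily N x z) (M : LieSubalgebra ℂ R)
    (hX : ∑ k ∈ Finset.range (N + 1), x k ∈ M) (hZ : ∑ k ∈ Finset.range (N + 1), z k ∈ M) :
    ∑ k ∈ Finset.range (N + 1), x k * z k ∈ M := by
  have e : ∑ k ∈ Finset.range (N + 1), x k * z k = (1 / 2 : ℂ) •
      ⁅∑ k ∈ Finset.range (N + 1), x k, ∑ k ∈ Finset.range (N + 1), z k⁆ := by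
    rw [lie_sum, Finset.smul_sum]
    refine Finset.sum_congr rfl fun k hk => ?_
    rw [h.sum_x_lie_z (by simpa [Nat.lt_succ_iff] using hk)]
    module
  rw [e]
  exact M.smul_mem _ (M.lie_mem hX hZ)

theorem ising_x_mem (h : IsPauliFamily N x z) (M : LieSubalgebra ℂ R) (g : ℕ → ℂ)
    (hJ : ∑ k ∈ Finset.range (N + 1), x k * z k ∈ M)
    (hQ : ∑ k ∈ Finset.range N, g k • (z k * z (k + 1)) ∈ M) :
    ∑ k ∈ Finset.range N, g k • (x k * x (k + 1)) ∈ M := by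
  set J := ∑ k ∈ Finset.range (N + 1), x k * z k
  have e : ∑ k ∈ Finset.range N, g k • (x k * x (k + 1)) =
      ∑ k ∈ Finset.range N, g k • (z k * z (k + 1)) +
        (1 / 8 : ℂ) • ⁅J, ⁅J, ∑ k ∈ Finset.range N, g k • (z k * z (k + 1))⁆⁆ := by
    rw [lie_sum, lie_sum, Finset.smul_sum, ← Finset.sum_add_distrib]
    refine Finset.sum_congr rfl fun k hk => ?_
    have hk' := Finset.mem_range.1 hk
    rw [lie_lie_mul (h.sum_xz_lie_z hk'.le) (h.sum_xz_lie_x hk'.le) (h.sum_xz_lie_z hk')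
      (h.sum_xz_lie_x hk'), lie_smul, lie_smul]
    module
  rw [e]
  exact add_mem hQ (M.smul_mem _ (M.lie_mem hJ (M.lie_mem hJ hQ)))

end IsPauliFamily

end Chain

/-! ### Isolating the first site, then propagating along the chain. -/

section Extraction

variable {R : Type*} [Ring R] [Algebra ℂ R]

namespace IsPauliFamily

variable {N : ℕ} {x z : ℕ → R}

/-- The local field of the Ising coupling at the site `l`. -/
def localField (N : ℕ) (x : ℕ → R) (g : ℕ → ℂ) (l : ℕ) : R :=
  (if l < N then g l • x (l + 1) else 0) + (if 0 < l then g (l - 1) • x (l - 1) else 0)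

theorem commute_localField {y : R} {l : ℕ} (hl : l ≤ N) (g : ℕ → ℂ)
    (hy : ∀ k ≤ N, k ≠ l → Commute (x k) y) : Commute (localField N x g l) y := by
  refine Commute.add_left ?_ ?_
  · split_ifs with hlt
    · exact (hy _ hlt (by omega)).smul_left _
    · exact Commute.zero_left _
  · split_ifs with hlt
    · exact (hy _ (by omega) (by omega)).smul_left _
    · exact Commute.zero_left _

/-- Puts the coupling in the form `r + x m` that `ising_lie_lie` needs, with `r` collecting the
bonds away from `l`. -/
theorem sum_ising_eq (h : IsPauliFamily N x z) (g : ℕ → ℂ) {l : ℕ} (hl : l ≤ N) :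
    ∑ k ∈ Finset.range N, g k • (x k * x (k + 1)) =
      ∑ k ∈ (Finset.range N).filter (fun k => k ≠ l ∧ k + 1 ≠ l), g k • (x k * x (k + 1)) +
        x l * localField N x g l := by
  have e : ∑ k ∈ (Finset.range N).filter (fun k => ¬ (k ≠ l ∧ k + 1 ≠ l)),
      g k • (x k * x (k + 1)) = x l * localField N x g l := by
    have e1 : ∀ k, (if ¬ (k ≠ l ∧ k + 1 ≠ l) then g k • (x k * x (k + 1)) else 0) =
        (if k = l then g k • (x k * x (k + 1)) else 0) +
          if k + 1 = l then g k • (x k * x (k + 1)) else 0 := fun k => by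
      by_cases h1 : k = l
      · have h2 : k + 1 ≠ l := by omega
        simp [h1]
      · by_cases h2 : k + 1 = l <;> simp [h1, h2]
    rw [Finset.sum_filter, Finset.sum_congr rfl fun k _ => e1 k, Finset.sum_add_distrib,
      localField, mul_add]
    congr 1
    · rw [Finset.sum_ite_eq']
      simp only [Finset.mem_range]
      split_ifs <;> simp
    · rcases Nat.eq_zero_or_pos l with rfl | h0
      · simp
      · obtain ⟨m, rfl⟩ := Nat.exists_eq_succ_of_ne_zero h0.ne'
        simp only [Nat.succ_eq_add_one, Nat.add_right_cancel_iff, Finset.sum_ite_eq',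
          Finset.mem_range, if_pos (show m < N from hl), if_pos h0, Nat.add_sub_cancel,
          mul_smul_comm]
        rw [(h.comm_xx m (by omega) (m + 1) hl (by omega)).eq]
  rw [← e, Finset.sum_filter_add_sum_filter_not]

/-- A quarter of the squared bracket with the Ising coupling. -/
noncomputable def isingSq (N : ℕ) (x : ℕ → R) (g : ℕ → ℂ) : R →ₗ[ℂ] R where
  toFun y := (1 / 4 : ℂ) • ⁅∑ k ∈ Finset.range N, g k • (x k * x (k + 1)),
    ⁅∑ k ∈ Finset.range N, g k • (x k * x (k + 1)), y⁆⁆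
  map_add' y y' := by rw [lie_add, lie_add, smul_add]
  map_smul' c y := by rw [lie_smul, lie_smul, smul_comm, RingHom.id_apply]

/-- The extra factor `Y` allows iteration: the squared local field produced here is a polynomial in
the `x k`, hence an admissible `Y` for the next application. -/
theorem isingSq_apply (h : IsPauliFamily N x z) (g : ℕ → ℂ) {l : ℕ} (hl : l ≤ N) {Y : R}
    (hY : ∀ k ≤ N, Commute (x k) Y) :
    isingSq N x g (z l * Y) = z l * (localField N x g l * localField N x g l * Y) := by
  have hr : ∀ y, (∀ k ≤ N, k ≠ l → Commute (x k) y) →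
      Commute (∑ k ∈ (Finset.range N).filter (fun k => k ≠ l ∧ k + 1 ≠ l),
        g k • (x k * x (k + 1))) y := fun y hy => by
    refine Commute.sum_left _ _ _ fun k hk => ?_
    simp only [Finset.mem_filter, Finset.mem_range] at hk
    exact ((hy k hk.1.le hk.2.1).mul_left (hy (k + 1) hk.1 hk.2.2)).smul_left _
  have hxx : ∀ k ≤ N, ∀ k' ≤ N, Commute (x k) (x k') := fun k hk k' hk' => by
    rcases eq_or_ne k k' with rfl | hkk
    · exact Commute.refl _
    · exact h.comm_xx k hk k' hk' hkk
  simp only [isingSq, LinearMap.coe_mk, AddHom.coe_mk]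
  rw [h.sum_ising_eq g hl, ising_lie_lie (h.xx l hl) (h.zx l hl)
    (hr _ fun k hk _ => hxx k hk l hl) (hr _ fun k hk hkl => h.comm_xz k hk l hl hkl)
    (hr _ fun k hk _ => (commute_localField hl g fun k' hk' _ => hxx k' hk' k hk).symm)
    (commute_localField hl g fun k hk _ => hxx k hk l hl)
    (commute_localField hl g fun k hk hkl => h.comm_xz k hk l hl hkl)
    (hr _ fun k hk _ => hY k hk) (hY l hl) (commute_localField hl g fun k hk _ => hY k hk),
    smul_smul]
  norm_num

theorem isingSq_sub_apply (h : IsPauliFamily N x z) (g : ℕ → ℂ) {l : ℕ} (hl : l ≤ N) (c : ℂ) {Y : R}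
    (hY : ∀ k ≤ N, Commute (x k) Y) :
    (isingSq N x g - c • (LinearMap.id : R →ₗ[ℂ] R)) (z l * Y) =
      z l * ((localField N x g l * localField N x g l - c • 1) * Y) := by
  rw [LinearMap.sub_apply, h.isingSq_apply g hl hY]
  simp [sub_mul, mul_sub]

/-- The polynomial in `isingSq` that isolates the first site. -/
noncomputable def siteFilter (N : ℕ) (x : ℕ → R) (g : ℕ → ℂ) (a b : ℂ) : R →ₗ[ℂ] R :=
  (isingSq N x g - a ^ 2 • LinearMap.id).comp
    ((isingSq N x g - (a - b) ^ 2 • LinearMap.id).comp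
      (isingSq N x g - (a + b) ^ 2 • LinearMap.id))

theorem siteFilter_apply (h : IsPauliFamily N x z) (g : ℕ → ℂ) (a b : ℂ) {l : ℕ} (hl : l ≤ N) :
    siteFilter N x g a b (z l) =
      z l * ((localField N x g l * localField N x g l - a ^ 2 • 1) *
        ((localField N x g l * localField N x g l - (a - b) ^ 2 • 1) *
          (localField N x g l * localField N x g l - (a + b) ^ 2 • 1))) := by
  have hxx : ∀ k ≤ N, ∀ k' ≤ N, Commute (x k) (x k') := fun k hk k' hk' => by
    rcases eq_or_ne k k' with rfl | hkk
    · exact Commute.refl _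
    · exact h.comm_xx k hk k' hk' hkk
  have hm : ∀ k ≤ N, Commute (x k) (localField N x g l) := fun k hk =>
    (commute_localField hl g fun k' hk' _ => hxx k' hk' k hk).symm
  have hc : ∀ c : ℂ, ∀ k ≤ N, Commute (x k)
      (localField N x g l * localField N x g l - c • 1) := fun c k hk =>
    ((hm k hk).mul_right (hm k hk)).sub_right ((Commute.one_right _).smul_right _)
  have h1 := h.isingSq_sub_apply g hl ((a + b) ^ 2) (Y := 1) fun k _ => Commute.one_right _
  rw [mul_one, mul_one] at h1
  rw [siteFilter, LinearMap.comp_apply, LinearMap.comp_apply, h1,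
    h.isingSq_sub_apply g hl _ (hc _),
    h.isingSq_sub_apply g hl _ fun k hk => (hc _ k hk).mul_right (hc _ k hk)]

/-- The filter `(T - a^2)(T - (a-b)^2)(T - (a+b)^2)` is applied to `∑ z k`. Its first factor removes
the last site and the other two the interior sites; the first site, where the squared local field is
`b^2`, survives with a nonzero scalar. -/
theorem z_zero_mem (h : IsPauliFamily N x z) (hN : 0 < N) (M : LieSubalgebra ℂ R) (g : ℕ → ℂ)
    (a b : ℂ) (hg0 : g 0 = b) (hgN : g (N - 1) = a)
    (hadd : ∀ l, 0 < l → l < N → (g l + g (l - 1)) ^ 2 = (a + b) ^ 2)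
    (hsub : ∀ l, 0 < l → l < N → (g l - g (l - 1)) ^ 2 = (a - b) ^ 2)
    (hab : a ^ 2 ≠ b ^ 2) (ha : a ≠ 0) (hab4 : a ^ 2 ≠ 4 * b ^ 2)
    (hZ : ∑ k ∈ Finset.range (N + 1), z k ∈ M)
    (hq : ∑ k ∈ Finset.range N, g k • (x k * x (k + 1)) ∈ M) : z 0 ∈ M := by
  have hF : ∀ c : ℂ, ∀ y ∈ M, (isingSq N x g - c • (LinearMap.id : R →ₗ[ℂ] R)) y ∈ M := fun c y hy =>
    sub_mem (M.smul_mem _ (M.lie_mem hq (M.lie_mem hq hy))) (M.smul_mem _ hy)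
  have hG : siteFilter N x g a b (∑ k ∈ Finset.range (N + 1), z k) ∈ M := hF _ _ (hF _ _ (hF _ _ hZ))
  have hsc : ∀ u v : ℂ, u • (1 : R) - v • (1 : R) = (u - v) • 1 := fun u v => (sub_smul _ _ _).symm
  have h0 : siteFilter N x g a b (z 0) =
      ((b ^ 2 - a ^ 2) * ((b ^ 2 - (a - b) ^ 2) * (b ^ 2 - (a + b) ^ 2))) • z 0 := by
    have e : localField N x g 0 * localField N x g 0 = b ^ 2 • (1 : R) := by
      simp only [localField, if_pos hN, lt_irrefl, if_false, add_zero, smul_mul_smul_comm, hg0,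
        h.xx 1 hN, zero_add, sq]
    rw [h.siteFilter_apply g a b (Nat.zero_le _), e]
    simp only [hsc, mul_one, mul_smul_comm]
    module
  have hne : ∀ l ∈ Finset.range (N + 1), l ≠ 0 → siteFilter N x g a b (z l) = 0 := by
    intro l hl hl0
    have hl' : l ≤ N := by simpa [Nat.lt_succ_iff] using hl
    have hpos : 0 < l := Nat.pos_of_ne_zero hl0
    rw [h.siteFilter_apply g a b hl']
    rcases hl'.eq_or_lt with rfl | hlt
    · have e : localField l x g l * localField l x g l = a ^ 2 • (1 : R) := by
        simp only [localField, lt_irrefl, if_false, if_pos hpos, zero_add, smul_mul_smul_comm, hgN,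
          h.xx (l - 1) (by omega), sq]
      rw [e, sub_self, zero_mul, mul_zero]
    · set u := x (l + 1) with hu
      set v := x (l - 1) with hv
      have huu : u * u = 1 := h.xx _ hlt
      have hvv : v * v = 1 := h.xx _ (by omega)
      have hvu : v * u = u * v := (h.comm_xx _ (by omega) _ hlt (by omega)).eq
      have huv : u * v * (u * v) = 1 := by
        rw [mul_assoc, ← mul_assoc v, hvu, mul_assoc u v v, hvv, mul_one, huu]
      have e : localField N x g l * localField N x g l =
          (g l ^ 2 + g (l - 1) ^ 2) • (1 : R) + (2 * g l * g (l - 1)) • (u * v) := by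
        simp only [localField, if_pos hlt, if_pos hpos, mul_add, add_mul, smul_mul_smul_comm]
        rw [← hu, ← hv, huu, hvv, hvu]
        module
      -- The two factors are multiples of `u v + 1` and `u v - 1`, whose product vanishes since `u
      -- v` is an involution.
      have e2 : ((g l ^ 2 + g (l - 1) ^ 2) • (1 : R) + (2 * g l * g (l - 1)) • (u * v)
            - (g l - g (l - 1)) ^ 2 • 1) *
          ((g l ^ 2 + g (l - 1) ^ 2) • (1 : R) + (2 * g l * g (l - 1)) • (u * v)
            - (g l + g (l - 1)) ^ 2 • 1) = 0 := by
        have e3 : (g l ^ 2 + g (l - 1) ^ 2) • (1 : R) + (2 * g l * g (l - 1)) • (u * v)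
            - (g l - g (l - 1)) ^ 2 • 1 = (2 * g l * g (l - 1)) • (u * v + 1) := by module
        have e4 : (g l ^ 2 + g (l - 1) ^ 2) • (1 : R) + (2 * g l * g (l - 1)) • (u * v)
            - (g l + g (l - 1)) ^ 2 • 1 = (2 * g l * g (l - 1)) • (u * v - 1) := by module
        rw [e3, e4, smul_mul_smul_comm, mul_sub, add_mul, huv]
        simp [add_comm]
      rw [e, ← hadd l hpos hlt, ← hsub l hpos hlt, e2, mul_zero, mul_zero]
  rw [map_sum, Finset.sum_eq_single_of_mem 0 (by simp) hne, h0] at hG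
  have hc : (b ^ 2 - a ^ 2) * ((b ^ 2 - (a - b) ^ 2) * (b ^ 2 - (a + b) ^ 2)) ≠ 0 := by
    -- This factorisation is where `a ≠ 0`, `a^2 ≠ b^2` and `a^2 ≠ 4 b^2` are needed.
    have e : (b ^ 2 - a ^ 2) * ((b ^ 2 - (a - b) ^ 2) * (b ^ 2 - (a + b) ^ 2)) =
        (b ^ 2 - a ^ 2) * (a ^ 2 * (a ^ 2 - 4 * b ^ 2)) := by ring
    rw [e]
    exact mul_ne_zero (sub_ne_zero.2 hab.symm) (mul_ne_zero (pow_ne_zero _ ha) (sub_ne_zero.2 hab4))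
  have := M.smul_mem (((b ^ 2 - a ^ 2) * ((b ^ 2 - (a - b) ^ 2) * (b ^ 2 - (a + b) ^ 2)))⁻¹) hG
  rwa [smul_smul, inv_mul_cancel₀ hc, one_smul] at this

/-- Starting from the first site, all the sites and all the bonds can be reached. -/
theorem z_mem_and_bond_mem (h : IsPauliFamily N x z) (M : LieSubalgebra ℂ R) (g : ℕ → ℂ)
    (hg : ∀ k < N, g k ≠ 0)
    (hX : ∑ k ∈ Finset.range (N + 1), x k ∈ M) (hZ : ∑ k ∈ Finset.range (N + 1), z k ∈ M)
    (hQ : ∑ k ∈ Finset.range N, g k • (z k * z (k + 1)) ∈ M) (h0 : z 0 ∈ M) :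
    (∀ k ≤ N, x k ∈ M ∧ z k ∈ M) ∧ ∀ k < N, z k * z (k + 1) ∈ M := by
  have hJ := h.sum_xz_mem M hX hZ
  have hjz : ∀ k ≤ N, z k ∈ M → x k * z k ∈ M := fun k hk hz => by
    have := M.smul_mem (1 / 2 : ℂ) (M.lie_mem hX hz)
    rwa [h.sum_x_lie_z hk, smul_smul, one_div_mul_cancel two_ne_zero, one_smul] at this
  have hxz : ∀ k ≤ N, z k ∈ M → x k ∈ M := fun k hk hz => by
    have := M.smul_mem (1 / 2 : ℂ) (M.lie_mem hJ hz)
    rwa [h.sum_xz_lie_z hk, smul_smul, one_div_mul_cancel two_ne_zero, one_smul] at this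
  have key : ∀ k ≤ N, z k ∈ M ∧ ∀ l < k, z l * z (l + 1) ∈ M := by
    intro k
    induction k with
    | zero => exact fun _ => ⟨h0, fun l hl => absurd hl (Nat.not_lt_zero l)⟩
    | succ k ih =>
      intro hk
      obtain ⟨hzk, hb⟩ := ih (by omega)
      have hk' : k ≤ N := by omega
      have hxk := hxz k hk' hzk
      have hcx : Commute (x k) (z (k + 1)) := h.comm_xz k hk' (k + 1) hk (by omega)
      have hcz : Commute (z k) (z (k + 1)) := h.comm_zz k hk' (k + 1) hk (by omega)
      have hxcx : Commute (x k) (x (k + 1)) := h.comm_xx k hk' (k + 1) hk (by omega)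
      have hzcx : Commute (z k) (x (k + 1)) :=
        (h.comm_xz (k + 1) hk k hk' (by omega)).symm
      -- With the bonds below `k` removed, the bond from `k` to `k + 1` is the only one left that
      -- touches site `k`, so bracketing with `x k` isolates it.
      have htail : ∑ l ∈ Finset.Ico k N, g l • (z l * z (l + 1)) ∈ M := by
        have := sub_mem hQ (sum_mem (t := Finset.range k) (f := fun l => g l • (z l * z (l + 1)))
          fun l hl => M.smul_mem _ (hb l (Finset.mem_range.1 hl)))
        rwa [← Finset.sum_Ico_eq_sub _ hk'] at this
      have h1 : (x k * z k) * z (k + 1) ∈ M := by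
        have h2 := M.lie_mem hxk htail
        rw [Finset.sum_eq_sum_Ico_succ_bot (by omega), lie_add, lie_sum,
          Finset.sum_eq_zero, add_zero, lie_smul, lie_mul_eq_add, hcx.lie_eq_zero, mul_zero,
          add_zero, pauli_lie_x_z (h.zx k hk'), smul_mul_assoc, smul_smul] at h2
        · have := M.smul_mem (g k * 2)⁻¹ h2
          rwa [smul_smul, inv_mul_cancel₀ (mul_ne_zero (hg k (by omega)) two_ne_zero),
            one_smul] at this
        · intro l hl
          have hl' := Finset.mem_Ico.1 hl
          rw [lie_smul, (((h.comm_xz k hk' l (by omega) (by omega)).mul_right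
            (h.comm_xz k hk' (l + 1) (by omega) (by omega)))).lie_eq_zero, smul_zero]
      have h2 : z k * z (k + 1) ∈ M := by
        have := M.smul_mem (1 / 2 : ℂ) (M.lie_mem hxk h1)
        rwa [lie_mul_eq_add, hcx.lie_eq_zero, mul_zero, add_zero,
          pauli_lie_x_xz (h.xx k hk') (h.zx k hk'), smul_mul_assoc, smul_smul,
          one_div_mul_cancel two_ne_zero, one_smul] at this
      have h3 : (x k * z k) * x (k + 1) ∈ M := by
        have h4 : x k * z (k + 1) ∈ M := by
          have := M.smul_mem (1 / 2 : ℂ) (M.lie_mem (hjz k hk' hzk) h2)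
          rwa [lie_mul_eq_add, (hcx.mul_left hcz).lie_eq_zero, mul_zero, add_zero,
            pauli_lie_xz_z (h.zz k hk') (h.zx k hk'), smul_mul_assoc, smul_smul,
            one_div_mul_cancel two_ne_zero, one_smul] at this
        have h5 : x k * x (k + 1) ∈ M := by
          have := add_mem (M.smul_mem (1 / 2 : ℂ) (M.lie_mem hJ h4)) h2
          rw [lie_mul_eq_add, h.sum_xz_lie_x hk', h.sum_xz_lie_z hk] at this
          convert this using 1
          simp only [smul_mul_assoc, mul_smul_comm]
          module
        have := M.smul_mem (1 / 2 : ℂ) (M.lie_mem h5 hzk)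
        rw [← lie_skew, lie_mul_eq_add, hzcx.lie_eq_zero, mul_zero, add_zero, ← lie_skew,
          pauli_lie_x_z (h.zx k hk')] at this
        convert this using 1
        simp only [neg_mul, neg_neg, smul_mul_assoc]
        module
      have hjj : (x k * z k) * (x k * z k) = -1 := by
        rw [mul_assoc, ← mul_assoc (z k), h.zx k hk', neg_mul, mul_neg, mul_assoc (x k) (z k),
          h.zz k hk', mul_one, h.xx k hk']
      have h4 : x (k + 1) * z (k + 1) ∈ M := by
        -- The common factor at site `k` squares to `-1`, so this bracket of two couplings is an
        -- operator at site `k + 1` alone.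
        have e : ⁅(x k * z k) * x (k + 1), (x k * z k) * z (k + 1)⁆ =
            (x k * z k) * (x k * z k) * ⁅x (k + 1), z (k + 1)⁆ := by
          rw [Ring.lie_def, Ring.lie_def, mul_sub, mul_assoc (x k * z k) (x (k + 1)),
            ← mul_assoc (x (k + 1)), ← (hxcx.mul_left hzcx).eq,
            mul_assoc (x k * z k) (z (k + 1)), ← mul_assoc (z (k + 1)),
            ← (hcx.mul_left hcz).eq]
          simp only [mul_assoc]
        have := M.smul_mem (-1 / 2 : ℂ) (M.lie_mem h3 h1)
        rw [e, hjj, pauli_lie_x_z (h.zx _ hk), neg_one_mul] at this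
        convert this using 1
        module
      have h5 : z (k + 1) ∈ M := by
        have := M.smul_mem (1 / 2 : ℂ) (M.lie_mem hX h4)
        rwa [h.sum_x_lie_xz hk, smul_smul, one_div_mul_cancel two_ne_zero, one_smul] at this
      refine ⟨h5, fun l hl => ?_⟩
      rcases Nat.lt_succ_iff_lt_or_eq.1 hl with hl | rfl
      · exact hb l hl
      · exact h2
  exact ⟨fun k hk => ⟨hxz k hk (key k hk).1, (key k hk).1⟩, fun k hk => (key N le_rfl).2 k hk⟩

end IsPauliFamily

end Extraction

/-! ### One-parameter groups in closed monoids of unitaries, and logarithms of unitaries. -/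

section Exponential

open NormedSpace Filter Topology

variable {A : Type*} [CStarAlgebra A]

theorem exp_mem_unitary_of_skew {a : A} (ha : a ∈ skewAdjoint A) : exp a ∈ unitary A :=
  let +nondep : NormedAlgebra ℚ A := .restrictScalars ℚ ℂ A
  exp_mem_unitary_of_mem_skewAdjoint ha

theorem exp_complex_add_of_commute {a b : A} (h : Commute a b) : exp (a + b) = exp a * exp b :=
  let +nondep : NormedAlgebra ℚ A := .restrictScalars ℚ ℂ A
  exp_add_of_commute h

theorem continuous_exp_cstar : Continuous (exp : A → A) :=
  let +nondep : NormedAlgebra ℚ A := .restrictScalars ℚ ℂ A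
  exp_continuous

theorem exp_nat_smul (m : ℕ) (a : A) : exp ((m : ℂ) • a) = exp a ^ m := by
  let +nondep : NormedAlgebra ℚ A := .restrictScalars ℚ ℂ A
  rw [Nat.cast_smul_eq_nsmul, exp_nsmul]

theorem exp_mul_exp_neg (a : A) : exp a * exp (-a) = 1 := by
  rw [← exp_complex_add_of_commute (Commute.refl a).neg_right, add_neg_cancel, exp_zero]

theorem exp_neg_mul_exp (a : A) : exp (-a) * exp a = 1 := by
  simpa using exp_mul_exp_neg (-a)

theorem real_smul_mem_skewAdjoint {a : A} (ha : a ∈ skewAdjoint A) (t : ℝ) :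
    (t : ℂ) • a ∈ skewAdjoint A := by
  rw [skewAdjoint.mem_iff] at ha ⊢
  rw [star_smul, ha, smul_neg]
  simp

/-- Telescoping, with unitary factors preserving norms. The linear growth in `m` is what an `o(1/m)`
error in the Lie product formula can absorb. -/
theorem norm_pow_sub_pow_le_of_unitary {P Q : A} (hP : P ∈ unitary A) (hQ : Q ∈ unitary A) (m : ℕ) :
    ‖P ^ m - Q ^ m‖ ≤ m * ‖P - Q‖ := by
  induction m with
  | zero => simp
  | succ m ih =>
    have e : P ^ (m + 1) - Q ^ (m + 1) = P ^ m * (P - Q) + (P ^ m - Q ^ m) * Q := by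
      rw [pow_succ, pow_succ, mul_sub, sub_mul]
      abel
    rw [e]
    refine (norm_add_le _ _).trans ?_
    rw [CStarRing.norm_mem_unitary_mul _ (pow_mem hP m), CStarRing.norm_mul_mem_unitary _ hQ]
    push_cast
    linarith

theorem tendsto_one_div_nat_nhdsNE :
    Tendsto (fun m : ℕ => ((1 / ((m : ℝ) + 1) : ℝ) : ℂ)) atTop (𝓝[≠] 0) := by
  refine tendsto_nhdsWithin_iff.2 ⟨?_, Eventually.of_forall fun m => ?_⟩
  · have := (Complex.continuous_ofReal.tendsto 0).comp tendsto_one_div_add_atTop_nhds_zero_nat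
    rw [Complex.ofReal_zero] at this
    exact this
  · have : (1 / ((m : ℝ) + 1) : ℝ) ≠ 0 := by positivity
    exact Complex.ofReal_ne_zero.2 this

/-- The Lie product formula for skew-adjoint elements. -/
theorem tendsto_exp_mul_exp_pow {a b : A} (ha : a ∈ skewAdjoint A) (hb : b ∈ skewAdjoint A) :
    Tendsto (fun m : ℕ => (exp (((1 / ((m : ℝ) + 1) : ℝ) : ℂ) • a) *
      exp (((1 / ((m : ℝ) + 1) : ℝ) : ℂ) • b)) ^ (m + 1)) atTop (𝓝 (exp (a + b))) := by
  -- The two sides agree to first order at 0, so at `u = 1/(m+1)` their difference is `o(1/m)`.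
  have hd : HasDerivAt (fun u : ℂ => exp (u • a) * exp (u • b) - exp (u • (a + b))) 0 0 := by
    have h := ((hasDerivAt_exp_smul_const a (0 : ℂ)).mul (hasDerivAt_exp_smul_const b (0 : ℂ))).sub
      (hasDerivAt_exp_smul_const (a + b) (0 : ℂ))
    simpa using! h
  have ht := (hd.tendsto_slope_zero.comp tendsto_one_div_nat_nhdsNE).norm
  rw [tendsto_iff_norm_sub_tendsto_zero]
  rw [norm_zero] at ht
  refine squeeze_zero (fun _ => norm_nonneg _) (fun m => ?_) ht
  set u : ℝ := 1 / ((m : ℝ) + 1) with hu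
  have hQ : exp (a + b) = exp ((u : ℂ) • (a + b)) ^ (m + 1) := by
    rw [← exp_nat_smul, smul_smul]
    have : ((m + 1 : ℕ) : ℂ) * (u : ℂ) = 1 := by
      have h0 : (m : ℂ) + 1 ≠ 0 := Nat.cast_add_one_ne_zero m
      rw [hu]
      push_cast
      field_simp
    rw [this, one_smul]
  rw [hQ]
  refine (norm_pow_sub_pow_le_of_unitary
    (mul_mem (exp_mem_unitary_of_skew (real_smul_mem_skewAdjoint ha u))
      (exp_mem_unitary_of_skew (real_smul_mem_skewAdjoint hb u)))
    (exp_mem_unitary_of_skew (real_smul_mem_skewAdjoint (add_mem ha hb) u)) (m + 1)).trans_eq ?_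
  simp only [Function.comp_apply, zero_add, zero_smul, exp_zero, mul_one, sub_self, sub_zero,
    norm_smul, norm_inv]
  rw [Complex.norm_real, Real.norm_eq_abs, abs_of_nonneg (by positivity), hu, one_div, inv_inv]
  push_cast
  rfl

theorem tendsto_conj_exp_slope (a b : A) :
    Tendsto (fun m : ℕ => (((1 / ((m : ℝ) + 1) : ℝ) : ℂ))⁻¹ •
      (exp (((1 / ((m : ℝ) + 1) : ℝ) : ℂ) • a) * b * exp (-(((1 / ((m : ℝ) + 1) : ℝ) : ℂ) • a)) - b))
      atTop (𝓝 (a * b - b * a)) := by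
  have hd : HasDerivAt (fun u : ℂ => exp (u • a) * b * exp (u • (-a))) (a * b - b * a) 0 := by
    have h := ((hasDerivAt_exp_smul_const a (0 : ℂ)).mul_const b).mul
      (hasDerivAt_exp_smul_const (-a) (0 : ℂ))
    simpa [sub_eq_add_neg] using! h
  have ht := hd.tendsto_slope_zero.comp tendsto_one_div_nat_nhdsNE
  refine ht.congr fun m => ?_
  simp

section OneParameter

variable (G : Submonoid A)

/-- The skew-adjoint elements whose one-parameter group lies in `G`. -/
def IsOneParameterGenerator (a : A) : Prop :=
  a ∈ skewAdjoint A ∧ ∀ t : ℝ, exp ((t : ℂ) • a) ∈ G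

variable {G} {a b : A}

namespace IsOneParameterGenerator

theorem zero : IsOneParameterGenerator G (0 : A) :=
  ⟨zero_mem _, fun t => by rw [smul_zero, exp_zero]; exact one_mem G⟩

theorem real_smul (ha : IsOneParameterGenerator G a) (s : ℝ) :
    IsOneParameterGenerator G ((s : ℂ) • a) :=
  ⟨real_smul_mem_skewAdjoint ha.1 s, fun t => by
    rw [smul_smul, ← Complex.ofReal_mul]
    exact ha.2 _⟩

theorem add (hG : IsClosed (G : Set A)) (ha : IsOneParameterGenerator G a)
    (hb : IsOneParameterGenerator G b) : IsOneParameterGenerator G (a + b) := by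
  refine ⟨add_mem ha.1 hb.1, fun t => ?_⟩
  rw [smul_add]
  refine hG.mem_of_tendsto (tendsto_exp_mul_exp_pow (real_smul_mem_skewAdjoint ha.1 t)
    (real_smul_mem_skewAdjoint hb.1 t)) (Eventually.of_forall fun m => pow_mem (mul_mem ?_ ?_) _)
  · exact (ha.real_smul t).2 _
  · exact (hb.real_smul t).2 _

theorem of_tendsto (hG : IsClosed (G : Set A)) {f : ℕ → A}
    (hf : ∀ m, IsOneParameterGenerator G (f m)) (h : Tendsto f atTop (𝓝 a)) :
    IsOneParameterGenerator G a := by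
  refine ⟨?_, fun t => ?_⟩
  · have h1 : Tendsto (fun m => star (f m) + f m) atTop (𝓝 (star a + a)) :=
      ((continuous_star.tendsto a).comp h).add h
    have h2 : star a + a = 0 := tendsto_nhds_unique h1 (by
      have : ∀ m, star (f m) + f m = 0 := fun m => by
        rw [skewAdjoint.mem_iff.1 (hf m).1, neg_add_cancel]
      simp only [this]
      exact tendsto_const_nhds)
    exact skewAdjoint.mem_iff.2 (eq_neg_of_add_eq_zero_left h2)
  · exact hG.mem_of_tendsto ((continuous_exp_cstar.tendsto _).comp (h.const_smul (t : ℂ)))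
      (Eventually.of_forall fun m => (hf m).2 t)

theorem conj (ha : IsOneParameterGenerator G a) (hb : IsOneParameterGenerator G b) :
    IsOneParameterGenerator G (exp a * b * exp (-a)) := by
  let u : Aˣ := ⟨exp a, exp (-a), exp_mul_exp_neg a, exp_neg_mul_exp a⟩
  have hea : exp a ∈ G := by simpa using ha.2 1
  have hea' : exp (-a) ∈ G := by simpa using ha.2 (-1)
  refine ⟨?_, fun t => ?_⟩
  · have hs : star (exp a) = exp (-a) := by
      rw [star_exp, skewAdjoint.mem_iff.1 ha.1]
    have := skewAdjoint.conjugate hb.1 (exp a)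
    rwa [hs] at this
  · have e : (t : ℂ) • (exp a * b * exp (-a)) = u * ((t : ℂ) • b) * ↑u⁻¹ := by
      change _ = exp a * ((t : ℂ) • b) * exp (-a)
      simp
    let +nondep : NormedAlgebra ℚ A := .restrictScalars ℚ ℂ A
    rw [e, exp_units_conj]
    exact mul_mem (mul_mem hea (hb.2 t)) hea'

/-- The bracket is the derivative at 0 of conjugation by `exp (u a)`. The difference quotients are
generators by `conj`, `add` and `real_smul`, and generators are closed under limits. -/
theorem lie (hG : IsClosed (G : Set A)) (ha : IsOneParameterGenerator G a)
    (hb : IsOneParameterGenerator G b) : IsOneParameterGenerator G (a * b - b * a) := by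
  refine of_tendsto hG (fun m => ?_) (tendsto_conj_exp_slope a b)
  set u : ℝ := 1 / ((m : ℝ) + 1)
  rw [← Complex.ofReal_inv, sub_eq_add_neg]
  refine real_smul (add hG ((ha.real_smul u).conj hb) ?_) _
  simpa using hb.real_smul (-1)

end IsOneParameterGenerator

end OneParameter

/-- Recurrence: in finite dimension, the inverse of a unitary is a limit of its powers. -/
theorem star_mem_closure_range_pow [FiniteDimensional ℂ A] {u : A} (hu : u ∈ unitary A) :
    star u ∈ closure (Set.range (u ^ · : ℕ → A)) := by
  have : ProperSpace A := FiniteDimensional.proper ℂ A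
  have hc : IsCompact (unitary A : Set A) := by
    refine Metric.isCompact_of_isClosed_isBounded isClosed_unitary ?_
    refine (Metric.isBounded_closedBall (x := (0 : A)) (r := 1)).subset fun v hv => ?_
    rw [mem_closedBall_zero_iff]
    nontriviality A
    exact (CStarRing.norm_of_mem_unitary hv).le
  have : CompactSpace (unitary A) := isCompact_iff_compactSpace.1 hc
  let y : unitary A := ⟨u, hu⟩
  have h : y⁻¹ ∈ closure (Set.range (y ^ · : ℕ → unitary A)) := by
    -- In a compact group, the natural powers of an element have the same closure as its integer
    -- powers.
    rw [← closure_range_zpow_eq_pow]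
    exact subset_closure ⟨-1, by simp⟩
  have h2 := image_closure_subset_closure_image (continuous_subtype_val (p := (· ∈ unitary A)))
    (Set.mem_image_of_mem _ h)
  rw [← Set.range_comp] at h2
  exact h2

/-- Powers reach all positive times from a short interval; negative times are inverses of positive
ones, which recurrence puts in the closed monoid although it need not be assumed a group. -/
theorem isOneParameterGenerator_of_small [FiniteDimensional ℂ A] {G : Submonoid A}
    (hG : IsClosed (G : Set A)) {a : A} (ha : a ∈ skewAdjoint A) {r : ℝ} (hr : 0 < r)
    (h : ∀ t ∈ Set.Icc 0 r, exp ((t : ℂ) • a) ∈ G) : IsOneParameterGenerator G a := by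
  have hpos : ∀ t : ℝ, 0 ≤ t → exp ((t : ℂ) • a) ∈ G := fun t ht => by
    obtain ⟨m, hm⟩ := exists_nat_gt (t / r)
    have hm0 : (0 : ℝ) < m := (by positivity : 0 ≤ t / r).trans_lt hm
    have e : (t : ℂ) • a = (m : ℂ) • ((t / m : ℝ) : ℂ) • a := by
      rw [smul_smul]
      congr 1
      push_cast
      field_simp [(Nat.cast_ne_zero (R := ℂ)).2 (Nat.cast_pos.1 hm0).ne']
    rw [e, exp_nat_smul]
    refine pow_mem (h _ ⟨by positivity, ?_⟩) m
    rw [div_lt_iff₀ hr] at hm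
    rw [div_le_iff₀ hm0]
    linarith
  refine ⟨ha, fun t => ?_⟩
  rcases le_total 0 t with ht | ht
  · exact hpos t ht
  · have h1 := hpos (-t) (by linarith)
    have h2 := star_mem_closure_range_pow
      (exp_mem_unitary_of_skew (real_smul_mem_skewAdjoint ha (-t)))
    have h3 : star (exp (((-t : ℝ) : ℂ) • a)) = exp ((t : ℂ) • a) := by
      rw [star_exp, skewAdjoint.mem_iff.1 (real_smul_mem_skewAdjoint ha (-t))]
      simp
    rw [h3] at h2
    refine closure_minimal ?_ hG h2
    rintro _ ⟨m, rfl⟩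
    exact pow_mem h1 m

/-- Up to a phase, a unitary with finite spectrum is the exponential of a skew-adjoint element. -/
theorem exists_phase_exp_skewAdjoint {U : A} (hU : U ∈ unitary A) (hfin : (spectrum ℂ U).Finite) :
    ∃ (θ : ℝ) (S : A), S ∈ skewAdjoint A ∧ exp S = Complex.exp (Complex.I * θ) • U := by
  have hinj : Set.InjOn (fun θ : ℝ => -Complex.exp (-(Complex.I * θ))) (Set.Icc 0 1) := by
    intro s hs t ht hst
    obtain ⟨n, hn⟩ := Complex.exp_eq_exp_iff_exists_int.1 (neg_injective hst)
    have h1 : -s = -t + n * (2 * Real.pi) := by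
      have := congrArg Complex.im hn
      simpa using this
    have hpi := Real.pi_gt_three
    have hn0 : n = 0 := by
      have h2 : |(n : ℝ) * (2 * Real.pi)| ≤ 1 := by
        rw [abs_le]
        constructor <;> linarith [hs.1, hs.2, ht.1, ht.2]
      rw [abs_mul, abs_of_pos (by positivity : 0 < 2 * Real.pi)] at h2
      have h3 : |(n : ℝ)| < 1 := by nlinarith [abs_nonneg (n : ℝ)]
      rw [← Int.cast_abs] at h3
      exact Int.abs_lt_one_iff.1 (by exact_mod_cast h3)
    rw [hn0] at h1
    simp at h1
    exact h1
  -- Infinitely many phases against a finite spectrum: some `θ` keeps `-1` out of the spectrum of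
  -- `e^{iθ} U`, so that the principal logarithm is available.
  obtain ⟨θ, -, hθ⟩ : ∃ θ ∈ Set.Icc (0 : ℝ) 1,
      -Complex.exp (-(Complex.I * θ)) ∉ spectrum ℂ U := by
    by_contra! hcon
    exact ((Set.Icc_infinite (zero_lt_one (α := ℝ))).image hinj)
      (hfin.subset (Set.image_subset_iff.2 hcon))
  set c : ℂ := Complex.exp (Complex.I * θ) with hc
  have hc0 : c ≠ 0 := Complex.exp_ne_zero _
  have hV : c • U ∈ unitary A := by
    have hcc : star c * c = 1 := by
      rw [hc, Complex.star_def, ← Complex.exp_conj, ← Complex.exp_add]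
      simp
    rw [Unitary.mem_iff] at hU ⊢
    rw [star_smul, smul_mul_smul_comm, smul_mul_smul_comm, mul_comm c, hcc, hU.1, hU.2, one_smul]
    exact ⟨rfl, rfl⟩
  have hlt : ‖c • U - 1‖ < 2 := by
    rw [Unitary.norm_sub_one_lt_two_iff hV]
    intro hmem
    apply hθ
    have e : (-1 : ℂ) = Units.mk0 c hc0 • (-Complex.exp (-(Complex.I * θ))) := by
      rw [Units.smul_def, Units.val_mk0, smul_eq_mul, mul_neg, hc, ← Complex.exp_add]
      simp
    rw [e] at hmem
    exact spectrum.smul_mem_smul_iff.1 hmem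
  have h := expUnitary_argSelfAdjoint (u := ⟨c • U, hV⟩) hlt
  refine ⟨θ, Complex.I • (Unitary.argSelfAdjoint ⟨c • U, hV⟩ : A), ?_, congrArg Subtype.val h⟩
  exact (Unitary.argSelfAdjoint ⟨c • U, hV⟩).2.smul_mem_skewAdjoint Complex.conj_I

end Exponential

/-! ### The qubit chain as a Pauli family, and fullness of the complex Lie algebra. -/

section QubitChain

theorem sum_Icc_one_eq_sum_range {E : Type*} [AddCommMonoid E] (f : ℕ → E) (m : ℕ) :
    ∑ j ∈ Finset.Icc 1 m, f j = ∑ j ∈ Finset.range m, f (j + 1) := by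
  rw [Finset.range_eq_Ico, Finset.sum_Ico_add' f 0 m 1]
  rfl

theorem sum_range_two_mul {E : Type*} [AddCommMonoid E] (f : ℕ → E) (m : ℕ) :
    ∑ k ∈ Finset.range (2 * m), f k =
      ∑ j ∈ Finset.range m, f (2 * j) + ∑ j ∈ Finset.range m, f (2 * j + 1) := by
  induction m with
  | zero => simp
  | succ m ih =>
    rw [show 2 * (m + 1) = 2 * m + 1 + 1 by ring, Finset.sum_range_succ, Finset.sum_range_succ, ih,
      Finset.sum_range_succ, Finset.sum_range_succ]
    abel

theorem sum_range_two_mul_add_one {E : Type*} [AddCommMonoid E] (f : ℕ → E) (m : ℕ) :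
    ∑ k ∈ Finset.range (2 * m + 1), f k =
      ∑ j ∈ Finset.range m, f (2 * j + 1) + ∑ j ∈ Finset.range (m + 1), f (2 * j) := by
  rw [Finset.sum_range_succ, sum_range_two_mul, Finset.sum_range_succ]
  abel

theorem pauliX_mul_self : pauliX * pauliX = 1 := by
  ext i j
  fin_cases i <;> fin_cases j <;> simp [pauliX]

theorem pauliZ_mul_self : pauliZ * pauliZ = 1 := by
  ext i j
  fin_cases i <;> fin_cases j <;> simp [pauliZ]

theorem pauliZ_mul_pauliX : pauliZ * pauliX = -(pauliX * pauliZ) := by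
  ext i j
  fin_cases i <;> fin_cases j <;> simp [pauliX, pauliZ]

theorem siteOp_succ_of_lt {n k : ℕ} (hk : k < n) (A : Matrix (Fin 2) (Fin 2) ℂ) :
    siteOp n A (k + 1) = siteHom ⟨k, hk⟩ A :=
  siteOp_succ ⟨k, hk⟩ A

theorem isPauliFamily_siteOp (N : ℕ) : IsPauliFamily N
    (fun k => siteOp (N + 1) pauliX (k + 1)) (fun k => siteOp (N + 1) pauliZ (k + 1)) where
  xx k hk := by
    simp only [siteOp_succ_of_lt (Nat.lt_succ_of_le hk), ← map_mul, pauliX_mul_self, map_one]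
  zz k hk := by
    simp only [siteOp_succ_of_lt (Nat.lt_succ_of_le hk), ← map_mul, pauliZ_mul_self, map_one]
  zx k hk := by
    simp only [siteOp_succ_of_lt (Nat.lt_succ_of_le hk), ← map_mul, pauliZ_mul_pauliX, map_neg]
  comm_xx k hk l hl hkl := by
    simp only [siteOp_succ_of_lt (Nat.lt_succ_of_le hk), siteOp_succ_of_lt (Nat.lt_succ_of_le hl)]
    exact commute_siteHom (by simpa using hkl) _ _
  comm_xz k hk l hl hkl := by
    simp only [siteOp_succ_of_lt (Nat.lt_succ_of_le hk), siteOp_succ_of_lt (Nat.lt_succ_of_le hl)]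
    exact commute_siteHom (by simpa using hkl) _ _
  comm_zz k hk l hl hkl := by
    simp only [siteOp_succ_of_lt (Nat.lt_succ_of_le hk), siteOp_succ_of_lt (Nat.lt_succ_of_le hl)]
    exact commute_siteHom (by simpa using hkl) _ _

theorem mixerH_eq_sum (n : ℕ) :
    mixerH n = ∑ k ∈ Finset.range n, siteOp n pauliX (k + 1) :=
  sum_Icc_one_eq_sum_range _ _

/-- The field at the site `k`, counted from `0`. -/
noncomputable def chainField (ωA ωB : ℝ) (k : ℕ) : ℂ := if Even k then (ωB : ℂ) else ωA

/-- The coupling of the sites `k` and `k + 1`, counted from `0`. -/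
noncomputable def chainBond (γAB γBA : ℝ) (k : ℕ) : ℂ := if Even k then (γBA : ℂ) else γAB

theorem chainH_eq_sum (m : ℕ) (ωA ωB γAB γBA : ℝ) :
    chainH (2 * m + 1) ωA ωB γAB γBA =
      ∑ k ∈ Finset.range (2 * m + 1),
          chainField ωA ωB k • siteOp (2 * m + 1) pauliZ (k + 1) +
        ∑ k ∈ Finset.range (2 * m), chainBond γAB γBA k •
          (siteOp (2 * m + 1) pauliZ (k + 1) * siteOp (2 * m + 1) pauliZ (k + 1 + 1)) := by
  have hs : ∀ (r : ℝ) (M : QubitOp (2 * m + 1)), r • M = (r : ℂ) • M := fun r M =>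
    (algebraMap_smul ℂ r M).symm
  have hodd : ∀ j : ℕ, ¬ Even (2 * j + 1) := fun j => by simp
  rw [sum_range_two_mul_add_one, sum_range_two_mul, chainH, chainA, chainB, chainAB, chainBA,
    sum_Icc_one_eq_sum_range, sum_Icc_one_eq_sum_range, show (2 * m + 1) / 2 = m by omega,
    show (2 * m + 1 + 1) / 2 = m + 1 by omega, show (2 * m + 1 - 1) / 2 = m by omega]
  simp only [hs, chainField, chainBond, even_two_mul, if_true, hodd, if_false, ← Finset.smul_sum,
    mul_add, mul_one]
  abel

theorem eq_pauli_combination (A : Matrix (Fin 2) (Fin 2) ℂ) :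
    A = ((A 0 0 + A 1 1) / 2) • 1 + ((A 0 1 + A 1 0) / 2) • pauliX + ((A 0 0 - A 1 1) / 2) • pauliZ
      + ((A 1 0 - A 0 1) / 2) • (pauliX * pauliZ) := by
  ext i j
  fin_cases i <;> fin_cases j <;> simp [pauliX, pauliZ] <;> ring

/-- A space of `2 × 2` matrices that contains `1` and `Z` and is stable under brackets is full. -/
theorem submodule_eq_top_of_pauliZ_mem (p : Submodule ℂ (Matrix (Fin 2) (Fin 2) ℂ))
    (h1 : 1 ∈ p) (hZ : pauliZ ∈ p) (h : ∀ (A : Matrix (Fin 2) (Fin 2) ℂ), ∀ B ∈ p, ⁅A, B⁆ ∈ p) :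
    p = ⊤ := by
  have hJ : pauliX * pauliZ ∈ p := by
    have := p.smul_mem (1 / 2 : ℂ) (h pauliX _ hZ)
    rwa [pauli_lie_x_z pauliZ_mul_pauliX, smul_smul, one_div_mul_cancel two_ne_zero,
      one_smul] at this
  have hX : pauliX ∈ p := by
    have := p.smul_mem (1 / 2 : ℂ) (h (pauliX * pauliZ) _ hZ)
    rwa [pauli_lie_xz_z pauliZ_mul_self pauliZ_mul_pauliX, smul_smul,
      one_div_mul_cancel two_ne_zero, one_smul] at this
  refine eq_top_iff.2 fun A _ => ?_
  rw [eq_pauli_combination A]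
  exact add_mem (add_mem (add_mem (p.smul_mem _ h1) (p.smul_mem _ hX)) (p.smul_mem _ hZ))
    (p.smul_mem _ hJ)

/-- Brackets with one-site operators at `i`, then at `k`, change each factor of the ZZ-coupling
independently; identity factors are already covered by the one-site operators. -/
theorem couplings_mem_of_pauliZ {n : ℕ} (M : LieSubalgebra ℂ (QubitOp n)) {i k : Fin n}
    (hik : i ≠ k) (hs : ∀ i A, siteHom (n := n) i A ∈ M)
    (hb : siteHom i pauliZ * siteHom k pauliZ ∈ M) (A B : Matrix (Fin 2) (Fin 2) ℂ) :
    siteHom i A * siteHom k B ∈ M := by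
  have hA : ∀ A, siteHom i A * siteHom k pauliZ ∈ M := fun A => by
    let p : Submodule ℂ (Matrix (Fin 2) (Fin 2) ℂ) :=
      M.toSubmodule.comap
        ((LinearMap.mulRight ℂ (siteHom k pauliZ)).comp (siteHom i).toLinearMap)
    have hp : p = ⊤ := by
      refine submodule_eq_top_of_pauliZ_mem p ?_ hb fun C D hD => ?_
      · change siteHom i 1 * siteHom k pauliZ ∈ M
        rw [map_one, one_mul]
        exact hs _ _
      · change siteHom i ⁅C, D⁆ * siteHom k pauliZ ∈ M
        have := M.lie_mem (hs i C) hD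
        change ⁅siteHom i C, siteHom i D * siteHom k pauliZ⁆ ∈ M at this
        rwa [lie_mul_eq_add, (commute_siteHom hik _ _).lie_eq_zero, mul_zero, add_zero,
          Ring.lie_def, ← map_mul, ← map_mul, ← map_sub, ← Ring.lie_def] at this
    have : A ∈ p := hp ▸ Submodule.mem_top
    exact this
  let p : Submodule ℂ (Matrix (Fin 2) (Fin 2) ℂ) :=
    M.toSubmodule.comap ((LinearMap.mulLeft ℂ (siteHom i A)).comp (siteHom k).toLinearMap)
  have hp : p = ⊤ := by
    refine submodule_eq_top_of_pauliZ_mem p ?_ (hA A) fun C D hD => ?_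
    · change siteHom i A * siteHom k 1 ∈ M
      rw [map_one, mul_one]
      exact hs _ _
    · change siteHom i A * siteHom k ⁅C, D⁆ ∈ M
      have := M.lie_mem (hs k C) hD
      change ⁅siteHom k C, siteHom i A * siteHom k D⁆ ∈ M at this
      rwa [lie_mul_eq_add, (commute_siteHom hik.symm _ _).lie_eq_zero, zero_mul, zero_add,
        Ring.lie_def, ← map_mul, ← map_mul, ← map_sub, ← Ring.lie_def] at this
  have : B ∈ p := hp ▸ Submodule.mem_top
  exact this

/-- A complex Lie algebra that contains the identity, the mixer and the cost Hamiltonian of the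
chain contains all operators. -/
theorem lieSubalgebra_eq_top_of_chainH_mem {n : ℕ} (hn : Odd n) {ωA ωB γAB γBA : ℝ}
    (hωA : ωA ≠ 0) (hωB : ωB ≠ 0) (hω : ωA ^ 2 ≠ ωB ^ 2)
    (hγAB : γAB ≠ 0) (hγBA : γBA ≠ 0) (hγ : γAB ^ 2 ≠ γBA ^ 2)
    (hγ4 : γAB ^ 2 ≠ 4 * γBA ^ 2) (M : LieSubalgebra ℂ (QubitOp n)) (h1 : 1 ∈ M)
    (hX : mixerH n ∈ M) (hZ : chainH n ωA ωB γAB γBA ∈ M) : M = ⊤ := by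
  obtain ⟨m, rfl⟩ := hn
  have h := isPauliFamily_siteOp (2 * m)
  rw [mixerH_eq_sum] at hX
  rw [chainH_eq_sum] at hZ
  have hA : (ωA : ℂ) ≠ 0 := Complex.ofReal_ne_zero.2 hωA
  have hB : (ωB : ℂ) ≠ 0 := Complex.ofReal_ne_zero.2 hωB
  have hAB : (ωA : ℂ) ^ 2 - (ωB : ℂ) ^ 2 ≠ 0 := sub_ne_zero.2 (by exact_mod_cast hω)
  -- The two coefficients solve `α + β w^2 = 1/w` at `w = ωA` and `w = ωB`; this needs nonzero
  -- fields with distinct squares.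
  obtain ⟨hZs, hQ⟩ := h.sum_z_mem_and_ising_mem M (chainField ωA ωB) (chainBond γAB γBA)
    ((ωA : ℂ)⁻¹ - ((ωA : ℂ)⁻¹ - (ωB : ℂ)⁻¹) / ((ωA : ℂ) ^ 2 - (ωB : ℂ) ^ 2) * (ωA : ℂ) ^ 2)
    (((ωA : ℂ)⁻¹ - (ωB : ℂ)⁻¹) / ((ωA : ℂ) ^ 2 - (ωB : ℂ) ^ 2))
    (fun k _ => by
      rw [chainField]
      split_ifs <;> (field_simp; ring)) hX hZ
  have hz0 : siteOp (2 * m + 1) pauliZ (0 + 1) ∈ M := by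
    rcases Nat.eq_zero_or_pos m with rfl | hm
    -- For a single qubit the uniform field is already `z_0`.
    · simpa using hZs
    · have hpar : ∀ l, 0 < l → (Even l ∧ ¬ Even (l - 1)) ∨ (¬ Even l ∧ Even (l - 1)) := by
        intro l hl
        obtain ⟨l, rfl⟩ := Nat.exists_eq_succ_of_ne_zero hl.ne'
        simp only [Nat.succ_eq_add_one, Nat.add_sub_cancel, Nat.even_add_one]
        tauto
      refine h.z_zero_mem (by omega) M (chainBond γAB γBA) (γAB : ℂ) (γBA : ℂ) (by simp [chainBond])
        ?_ (fun l hl _ => ?_) (fun l hl _ => ?_) (by exact_mod_cast hγ)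
        (Complex.ofReal_ne_zero.2 hγAB) (by exact_mod_cast hγ4) hZs
        (h.ising_x_mem M _ (h.sum_xz_mem M hX hZs) hQ)
      · have : ¬ Even (2 * m - 1) := by
          rcases hpar (2 * m) (by omega) with hh | hh
          · exact hh.2
          · exact absurd (even_two_mul m) hh.1
        simp [chainBond, this]
      · rcases hpar l hl with hh | hh <;> simp [chainBond, hh.1, hh.2, add_comm]
      · rcases hpar l hl with hh | hh <;> simp only [chainBond, hh.1, hh.2, if_true, if_false]
        ring
  obtain ⟨hsite, hbond⟩ := h.z_mem_and_bond_mem M (chainBond γAB γBA) (fun k _ => by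
    rw [chainBond]
    split_ifs
    · exact Complex.ofReal_ne_zero.2 hγBA
    · exact Complex.ofReal_ne_zero.2 hγAB) hX hZs hQ hz0
  have hs : ∀ (i : Fin (2 * m + 1)) A, siteHom i A ∈ M := fun i A => by
    obtain ⟨hxi, hzi⟩ := hsite i (by omega)
    rw [siteOp_succ] at hxi hzi
    have hxz : siteHom i (pauliX * pauliZ) ∈ M := by
      have := M.smul_mem (1 / 2 : ℂ) (M.lie_mem hxi hzi)
      rwa [pauli_lie_x_z (by rw [← map_mul, pauliZ_mul_pauliX, map_neg, map_mul]), smul_smul,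
        one_div_mul_cancel two_ne_zero, one_smul, ← map_mul] at this
    rw [eq_pauli_combination A]
    simp only [map_add, map_smul]
    refine add_mem (add_mem (add_mem (M.smul_mem _ ?_) (M.smul_mem _ hxi)) (M.smul_mem _ hzi))
      (M.smul_mem _ hxz)
    rw [map_one]
    exact h1
  refine lieSubalgebra_eq_top_of_couplings M h1 hs fun i k hik A B => ?_
  refine couplings_mem_of_pauliZ M (fun e => by rw [e] at hik; omega) hs ?_ A B
  have := hbond i (by omega)
  rw [siteOp_succ] at this
  simp only [← hik] at this
  rwa [siteOp_succ] at this

end QubitChain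

/-! ### From the complex Lie algebra to unitaries, and approximation by QAOA circuits. -/

section Universality

variable {n : ℕ}

theorem real_smul_eq_ofReal_smul (r : ℝ) (M : QubitOp n) : r • M = (r : ℂ) • M :=
  (algebraMap_smul ℂ r M).symm

/-- The complex Lie algebra spanned by a real Lie algebra of operators and the identity. -/
def complexSpanWithOne (𝓛 : LieSubalgebra ℝ (QubitOp n)) : LieSubalgebra ℂ (QubitOp n) where
  carrier := {A | ∃ B ∈ 𝓛, ∃ C ∈ 𝓛, ∃ c : ℂ, A = B + Complex.I • C + c • 1}
  zero_mem' := ⟨0, zero_mem _, 0, zero_mem _, 0, by simp⟩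
  add_mem' := by
    rintro _ _ ⟨B, hB, C, hC, c, rfl⟩ ⟨B', hB', C', hC', c', rfl⟩
    exact ⟨B + B', add_mem hB hB', C + C', add_mem hC hC', c + c', by module⟩
  smul_mem' := by
    rintro s _ ⟨B, hB, C, hC, c, rfl⟩
    -- Real and imaginary parts of `s (B + iC)`.
    refine ⟨s.re • B + -(s.im • C), add_mem (𝓛.smul_mem _ hB) (neg_mem (𝓛.smul_mem _ hC)),
      s.im • B + s.re • C, add_mem (𝓛.smul_mem _ hB) (𝓛.smul_mem _ hC), s * c, ?_⟩
    simp only [real_smul_eq_ofReal_smul, smul_add, smul_smul]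
    have h1 : s * Complex.I = (s.re : ℂ) * Complex.I - s.im := by
      conv_lhs => rw [← Complex.re_add_im s]
      rw [add_mul, mul_assoc, Complex.I_mul_I]
      ring
    have h2 : s • B = (s.re : ℂ) • B + (Complex.I * s.im) • B := by
      rw [← add_smul, mul_comm Complex.I, Complex.re_add_im]
    rw [h1, h2]
    module
  lie_mem' := by
    rintro _ _ ⟨B, hB, C, hC, c, rfl⟩ ⟨B', hB', C', hC', c', rfl⟩
    refine ⟨⁅B, B'⁆ + -⁅C, C'⁆, add_mem (𝓛.lie_mem hB hB') (neg_mem (𝓛.lie_mem hC hC')),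
      ⁅B, C'⁆ + ⁅C, B'⁆, add_mem (𝓛.lie_mem hB hC') (𝓛.lie_mem hC hB'), 0, ?_⟩
    have h1 : ∀ y : QubitOp n, ⁅(1 : QubitOp n), y⁆ = 0 := fun y =>
      (Commute.one_left y).lie_eq_zero
    have h2 : ∀ y : QubitOp n, ⁅y, (1 : QubitOp n)⁆ = 0 := fun y =>
      (Commute.one_right y).lie_eq_zero
    simp only [lie_add, add_lie, lie_smul, smul_lie, h1, h2, smul_zero, add_zero, smul_add,
      smul_smul, Complex.I_mul_I]
    module

theorem mem_complexSpanWithOne {𝓛 : LieSubalgebra ℝ (QubitOp n)} {A : QubitOp n} :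
    A ∈ complexSpanWithOne 𝓛 ↔ ∃ B ∈ 𝓛, ∃ C ∈ 𝓛, ∃ c : ℂ, A = B + Complex.I • C + c • 1 :=
  Iff.rfl

theorem mem_complexSpanWithOne_of_I_smul_mem {𝓛 : LieSubalgebra ℝ (QubitOp n)} {H : QubitOp n}
    (h : Complex.I • H ∈ 𝓛) : H ∈ complexSpanWithOne 𝓛 :=
  mem_complexSpanWithOne.2 ⟨0, zero_mem _, -(Complex.I • H), neg_mem h, 0, by
    rw [smul_neg, smul_smul, Complex.I_mul_I]
    module⟩

theorem one_mem_complexSpanWithOne (𝓛 : LieSubalgebra ℝ (QubitOp n)) :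
    1 ∈ complexSpanWithOne 𝓛 :=
  mem_complexSpanWithOne.2 ⟨0, zero_mem _, 0, zero_mem _, 1, by simp⟩

/-- In `S = B + iC + c` the self-adjoint part is `iC + Re c`. It vanishes for skew-adjoint `S`,
leaving `B + i Im c`. -/
theorem exists_mem_eq_add_phase {𝓛 : LieSubalgebra ℝ (QubitOp n)}
    (hskew : ∀ B ∈ 𝓛, B ∈ skewAdjoint (QubitOp n)) (htop : complexSpanWithOne 𝓛 = ⊤)
    {S : QubitOp n} (hS : S ∈ skewAdjoint (QubitOp n)) :
    ∃ B ∈ 𝓛, ∃ φ : ℝ, S = B + (Complex.I * φ) • 1 := by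
  have : S ∈ complexSpanWithOne 𝓛 := htop ▸ LieSubalgebra.mem_top S
  obtain ⟨B, hB, C, hC, c, rfl⟩ := mem_complexSpanWithOne.1 this
  have hsB := skewAdjoint.mem_iff.1 (hskew B hB)
  have hsC := skewAdjoint.mem_iff.1 (hskew C hC)
  rw [skewAdjoint.mem_iff] at hS
  refine ⟨B, hB, c.im, ?_⟩
  simp only [star_add, star_smul, hsB, hsC, star_one, Complex.star_def, Complex.conj_I] at hS
  have h2 : (2 : ℂ) • (Complex.I • C) + (c + (starRingEnd ℂ) c) • (1 : QubitOp n) = 0 := by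
    have h3 := sub_eq_zero.2 hS
    have h4 : (2 : ℂ) • (Complex.I • C) + (c + (starRingEnd ℂ) c) • (1 : QubitOp n) =
        (-B + -Complex.I • -C + (starRingEnd ℂ) c • (1 : QubitOp n)) -
          -(B + Complex.I • C + c • (1 : QubitOp n)) := by module
    rw [h4, h3]
  rw [Complex.add_conj] at h2
  have h5 : Complex.I • C = -((c.re : ℂ) • (1 : QubitOp n)) := by
    have h6 : Complex.I • C = (1 / 2 : ℂ) • ((2 : ℂ) • (Complex.I • C) +
        ((2 * c.re : ℝ) : ℂ) • (1 : QubitOp n)) - (c.re : ℂ) • (1 : QubitOp n) := by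
      push_cast
      module
    rw [h6, h2, smul_zero, zero_sub]
  rw [h5]
  have h7 : c • (1 : QubitOp n) = (c.re + c.im * Complex.I) • 1 := by rw [Complex.re_add_im]
  rw [h7]
  module

theorem star_siteOp {A : Matrix (Fin 2) (Fin 2) ℂ} (hA : star A = A) (k : ℕ) :
    star (siteOp n A k) = siteOp n A k := by
  ext s t
  rw [Matrix.star_apply]
  simp only [siteOp, tensorOp, Matrix.of_apply, star_prod]
  refine Finset.prod_congr rfl fun i _ => ?_
  rw [← Matrix.star_apply]
  split_ifs
  · rw [hA]
  · rw [star_one]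

theorem star_pauliX : star pauliX = pauliX := by
  ext i j
  fin_cases i <;> fin_cases j <;> simp [pauliX]

theorem star_pauliZ : star pauliZ = pauliZ := by
  ext i j
  fin_cases i <;> fin_cases j <;> simp [pauliZ]

theorem star_mixerH : star (mixerH n) = mixerH n := by
  simp only [mixerH, star_sum, star_siteOp star_pauliX]

theorem star_chainH (hn : Odd n) (ωA ωB γAB γBA : ℝ) :
    star (chainH n ωA ωB γAB γBA) = chainH n ωA ωB γAB γBA := by
  obtain ⟨m, rfl⟩ := hn
  have hc : ∀ r s : ℝ, ∀ k : ℕ, star (if Even k then (r : ℂ) else s) = if Even k then (r : ℂ) else s :=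
    fun r s k => by split_ifs <;> simp
  rw [chainH_eq_sum, star_add, star_sum, star_sum]
  congr 1
  · refine Finset.sum_congr rfl fun k _ => ?_
    rw [star_smul, star_siteOp star_pauliZ, chainField, hc]
  · refine Finset.sum_congr rfl fun k hk => ?_
    have hk' := Finset.mem_range.1 hk
    rw [star_smul, star_mul, star_siteOp star_pauliZ, star_siteOp star_pauliZ, chainBond, hc,
      ((isPauliFamily_siteOp (2 * m)).comm_zz k (by omega) (k + 1) (by omega) (by omega)).eq]

theorem I_smul_mem_skewAdjoint {H : QubitOp n} (hH : star H = H) :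
    Complex.I • H ∈ skewAdjoint (QubitOp n) := by
  rw [skewAdjoint.mem_iff, star_smul, hH]
  simp

open scoped Matrix.Norms.L2Operator

/-- The real Lie algebra of the generators of the one-parameter groups in a closed monoid. -/
def oneParameterLie (G : Submonoid (QubitOp n)) (hG : IsClosed (G : Set (QubitOp n))) :
    LieSubalgebra ℝ (QubitOp n) where
  carrier := {a | IsOneParameterGenerator G a}
  zero_mem' := IsOneParameterGenerator.zero
  add_mem' ha hb := IsOneParameterGenerator.add hG ha hb
  smul_mem' r a ha := by
    rw [real_smul_eq_ofReal_smul]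
    exact IsOneParameterGenerator.real_smul ha r
  lie_mem' ha hb := IsOneParameterGenerator.lie hG ha hb

theorem evolution_eq_exp (H : QubitOp n) (t : ℝ) :
    evolution H t = NormedSpace.exp ((t : ℂ) • (-(Complex.I • H))) := by
  rw [evolution, smul_neg, smul_smul, neg_smul, mul_comm]

theorem evolution_zero (H : QubitOp n) : evolution H 0 = 1 := by
  rw [evolution_eq_exp, Complex.ofReal_zero, zero_smul, NormedSpace.exp_zero]

theorem I_smul_mem_oneParameterLie {G : Submonoid (QubitOp n)}
    (hG : IsClosed (G : Set (QubitOp n))) {H : QubitOp n} (hH : star H = H)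
    (h : ∀ t ∈ Set.Icc 0 (2 * Real.pi), evolution H t ∈ G) :
    Complex.I • H ∈ oneParameterLie G hG := by
  have h1 : -(Complex.I • H) ∈ oneParameterLie G hG :=
    isOneParameterGenerator_of_small hG (neg_mem (I_smul_mem_skewAdjoint hH)) Real.two_pi_pos
      fun t ht => by
        rw [← evolution_eq_exp]
        exact h t ht
  simpa using neg_mem h1

theorem exp_mem_of_mem_oneParameterLie {G : Submonoid (QubitOp n)}
    {hG : IsClosed (G : Set (QubitOp n))} {a : QubitOp n} (ha : a ∈ oneParameterLie G hG) :
    NormedSpace.exp a ∈ G := by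
  have := ha.2 1
  rwa [Complex.ofReal_one, one_smul] at this

theorem qaoaCircuits_mul_mem {HZ HX : QubitOp n} {p q : ℕ} {V W : QubitOp n}
    (hV : V ∈ qaoaCircuits HZ HX p) (hW : W ∈ qaoaCircuits HZ HX q) :
    V * W ∈ qaoaCircuits HZ HX (q + p) := by
  obtain ⟨γ, β, hγ, hβ, rfl⟩ := hV
  obtain ⟨γ', β', hγ', hβ', rfl⟩ := hW
  -- Layers are multiplied in reverse order, so the right factor `W` supplies the first layers.
  refine ⟨Fin.append γ' γ, Fin.append β' β, ?_, ?_, ?_⟩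
  · intro j
    refine Fin.addCases (fun i => ?_) (fun i => ?_) j
    · rw [Fin.append_left]
      exact hγ' i
    · rw [Fin.append_right]
      exact hγ i
  · intro j
    refine Fin.addCases (fun i => ?_) (fun i => ?_) j
    · rw [Fin.append_left]
      exact hβ' i
    · rw [Fin.append_right]
      exact hβ i
  · have e : (fun j => evolution HX (Fin.append β' β j) * evolution HZ (Fin.append γ' γ j)) =
        Fin.append (fun j => evolution HX (β' j) * evolution HZ (γ' j))
          (fun j => evolution HX (β j) * evolution HZ (γ j)) := by
      funext j
      refine Fin.addCases (fun i => ?_) (fun i => ?_) j <;> simp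
    rw [e, List.ofFn_fin_append, List.reverse_append, List.prod_append]

theorem evolution_mul_mem_qaoaUnitaries {HZ HX : QubitOp n} {γ β : ℝ}
    (hγ : γ ∈ Set.Icc 0 (2 * Real.pi)) (hβ : β ∈ Set.Icc 0 (2 * Real.pi)) :
    evolution HX β * evolution HZ γ ∈ qaoaUnitaries HZ HX :=
  Set.mem_biUnion (Set.mem_Ici.2 le_rfl : (1 : ℕ) ∈ Set.Ici 1)
    ⟨fun _ => γ, fun _ => β, fun _ => hγ, fun _ => hβ, by simp⟩

/-- The QAOA unitaries form a monoid. -/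
def qaoaMonoid (HZ HX : QubitOp n) : Submonoid (QubitOp n) where
  carrier := qaoaUnitaries HZ HX
  one_mem' := by
    have h0 : (0 : ℝ) ∈ Set.Icc 0 (2 * Real.pi) := ⟨le_rfl, Real.two_pi_pos.le⟩
    simpa [evolution_zero] using evolution_mul_mem_qaoaUnitaries (HZ := HZ) (HX := HX) h0 h0
  mul_mem' := by
    intro V W hV hW
    simp only [qaoaUnitaries, Set.mem_iUnion, Set.mem_Ici, exists_prop] at hV hW ⊢
    obtain ⟨p, hp, hV⟩ := hV
    obtain ⟨q, hq, hW⟩ := hW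
    exact ⟨q + p, by omega, qaoaCircuits_mul_mem hV hW⟩

/-- Setting one of the two angles of a single layer to 0 isolates the evolution under the other
Hamiltonian, so both generators lie in the Lie algebra of the closure. -/
theorem generatedLie_le_oneParameterLie {HZ HX : QubitOp n} (hZ : star HZ = HZ)
    (hX : star HX = HX) : generatedLie HZ HX ≤
      oneParameterLie (qaoaMonoid HZ HX).topologicalClosure
        (Submonoid.isClosed_topologicalClosure _) := by
  have h0 : (0 : ℝ) ∈ Set.Icc 0 (2 * Real.pi) := ⟨le_rfl, Real.two_pi_pos.le⟩
  refine LieSubalgebra.lieSpan_le.2 ?_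
  rintro _ (rfl | rfl)
  · refine I_smul_mem_oneParameterLie _ hZ fun t ht => Submonoid.le_topologicalClosure _ ?_
    have := evolution_mul_mem_qaoaUnitaries (HZ := HZ) (HX := HX) ht h0
    rwa [evolution_zero, one_mul] at this
  · refine I_smul_mem_oneParameterLie _ hX fun t ht => Submonoid.le_topologicalClosure _ ?_
    have := evolution_mul_mem_qaoaUnitaries (HZ := HZ) (HX := HX) h0 ht
    rwa [evolution_zero, mul_one] at this

/-- The logarithm of a phase multiple of `U` differs from an element of `𝓛` by an imaginary scalar,
whose exponential is again a phase. One exponential thus suffices, and there is no approximation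
error. -/
theorem exists_mem_expLie_eq_phase {𝓛 : LieSubalgebra ℝ (QubitOp n)}
    (hskew : ∀ B ∈ 𝓛, B ∈ skewAdjoint (QubitOp n)) (htop : complexSpanWithOne 𝓛 = ⊤)
    {U : QubitOp n} (hU : U ∈ Matrix.unitaryGroup (Fin n → Fin 2) ℂ) :
    ∃ V ∈ expLie 𝓛, ∃ θ : ℝ, V = Complex.exp (Complex.I * (θ : ℂ)) • U := by
  obtain ⟨θ, S, hS, hexp⟩ := exists_phase_exp_skewAdjoint hU (Matrix.finite_spectrum U)
  obtain ⟨B, hB, φ, rfl⟩ := exists_mem_eq_add_phase hskew htop hS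
  refine ⟨NormedSpace.exp B, ⟨[B], by simpa using hB, by simp⟩, θ - φ, ?_⟩
  have e1 : NormedSpace.exp ((Complex.I * φ) • (1 : QubitOp n)) =
      Complex.exp (Complex.I * φ) • (1 : QubitOp n) := by
    rw [← Algebra.algebraMap_eq_smul_one, ← Algebra.algebraMap_eq_smul_one, Complex.exp_eq_exp_ℂ]
    exact (NormedSpace.algebraMap_exp_comm (𝕂 := ℂ) (𝔸 := QubitOp n) (Complex.I * φ)).symm
  rw [exp_complex_add_of_commute ((Commute.one_right B).smul_right _), e1, mul_smul_comm,
    mul_one] at hexp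
  have e2 : Complex.exp (Complex.I * ((θ - φ : ℝ) : ℂ)) =
      Complex.exp (-(Complex.I * φ)) * Complex.exp (Complex.I * θ) := by
    rw [← Complex.exp_add]
    congr 1
    push_cast
    ring
  rw [e2, mul_smul, ← hexp, smul_smul, ← Complex.exp_add, neg_add_cancel, Complex.exp_zero,
    one_smul]

end Universality

open scoped Matrix.Norms.L2Operator in
theorem theorem1 (n : ℕ) (hn : Odd n) (ωA ωB γAB γBA : ℝ)
    (hωA : ωA ≠ 0) (hωB : ωB ≠ 0) (hω : ωA ^ 2 ≠ ωB ^ 2)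
    (hγAB : γAB ≠ 0) (hγBA : γBA ≠ 0) (hγ : γAB ^ 2 ≠ γBA ^ 2)
    (hγ4 : γAB ^ 2 ≠ 4 * γBA ^ 2) :
    (expLie (generatedLie (chainH n ωA ωB γAB γBA) (mixerH n)) ⊆
        (Matrix.unitaryGroup (Fin n → Fin 2) ℂ : Set (QubitOp n)) ∧
      ApproximatesUpToPhase (expLie (generatedLie (chainH n ωA ωB γAB γBA) (mixerH n)))) ∧
    QAOAUniversal (chainH n ωA ωB γAB γBA) (mixerH n) := by
  set HZ := chainH n ωA ωB γAB γBA with hHZ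
  have hle := generatedLie_le_oneParameterLie (star_chainH hn ωA ωB γAB γBA) (star_mixerH (n := n))
  rw [← hHZ] at hle
  -- Skew-adjointness is part of being a one-parameter generator, so the inclusion `hle` already
  -- contains it.
  have hskew : ∀ B ∈ generatedLie HZ (mixerH n), B ∈ skewAdjoint (QubitOp n) := fun B hB =>
    (hle hB).1
  have hsub : {Complex.I • HZ, Complex.I • mixerH n} ⊆
      (generatedLie HZ (mixerH n) : Set (QubitOp n)) :=
    LieSubalgebra.subset_lieSpan
  have htop : complexSpanWithOne (generatedLie HZ (mixerH n)) = ⊤ :=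
    lieSubalgebra_eq_top_of_chainH_mem hn hωA hωB hω hγAB hγBA hγ hγ4 _
      (one_mem_complexSpanWithOne _)
      (mem_complexSpanWithOne_of_I_smul_mem (hsub (by simp)))
      (mem_complexSpanWithOne_of_I_smul_mem (hsub (by simp [hHZ])))
  refine ⟨⟨?_, fun U hU ε hε => ?_⟩, fun U hU ε hε => ?_⟩
  · rintro _ ⟨l, hl, rfl⟩
    refine list_prod_mem fun V hV => ?_
    obtain ⟨A, hA, rfl⟩ := List.mem_map.1 hV
    exact exp_mem_unitary_of_skew (hskew A (hl A hA))
  · obtain ⟨V, hV, θ, rfl⟩ := exists_mem_expLie_eq_phase hskew htop hU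
    exact ⟨_, hV, θ, by simpa using hε⟩
  · obtain ⟨V, ⟨l, hl, rfl⟩, θ, hθ⟩ := exists_mem_expLie_eq_phase hskew htop hU
    have hmem : (l.map NormedSpace.exp).prod ∈ (qaoaMonoid HZ (mixerH n)).topologicalClosure := by
      refine list_prod_mem fun V hV => ?_
      obtain ⟨A, hA, rfl⟩ := List.mem_map.1 hV
      exact exp_mem_of_mem_oneParameterLie (hle (hl A hA))
    obtain ⟨W, hW, hdist⟩ := Metric.mem_closure_iff.1 hmem ε hε
    refine ⟨W, hW, θ, ?_⟩
    rw [← hθ, Matrix.l2_opNorm_toEuclideanCLM, ← dist_eq_norm, dist_comm]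
    exact hdist
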